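/- An algebraic computation tree (ACT) with real inputs $x_1,\dots,x_m$ is a finite rooted tree with three kinds of nodes. A computation node $v$ has one child and is labeled $y_v = y_u \oplus y_w$ with $\oplus\in\{+,-,\cdot,/\}$ or $y_v=\sqrt{y_u}$; a branch node has two children and tests either $y_u=0$ or $y_u>0$; a leaf names one variable $y_u$ as the answer. Here $y_u,y_w$ are always input variables or variables of computation nodes that are ancestors. Each input determines a path from the root to a leaf; for a tree to solve a problem, it must on every input meet no division by zero and no square root of a negative number on that path, and give the right answer at the leaf. The depth is the maximum number of computation and branch nodes on a root-to-leaf path. For two sequences $P=\langle p_1,\dots,p_n\rangle$ and $Q=\langle q_1,\dots,q_n\rangle$ of $n\ge 1$ points in the Euclidean plane and $\delta\ge 0$, let $G_\delta$ be the directed graph on the pairs $(p_i,q_j)$, $1\le i,j\le n$ (distinguished by their indices), with $d(p_i,q_j)\le\delta$, having an edge from $(p_i,q_j)$ to each of $(p_{i+1},q_j)$, $(p_i,q_{j+1})$, $(p_{i+1},q_{j+1})$ that is also a vertex of $G_\delta$. The discrete Fréchet distance of $P$ and $Q$ is the smallest $\delta$ for which $G_\delta$ has a path from $(p_1,q_1)$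 to $(p_n,q_n)$. Theorem. The discrete Fréchet problem has algebraic computation trees of depth $\widetilde O(n^{3/2})$. That is, there are constants $C>0$ and $k\in\mathbb N$ such that for every $n\ge1$ there is an ACT of depth at most $C\,n^{3/2}(\log(n+1))^k$ which, given the $4n$ coordinates of any two sequences $P,Q$ of $n$ points in the plane, outputs the discrete Fréchet distance of $P$ and $Q$. -/

import Mathlib

/-! ### Algebraic computation trees -/

/-- A variable available at a node of an algebraic computation tree: an input variable `x_i`, with
`i : ι`, or the variable of one of the `k` computation nodes that are ancestors of the node
(numbered from the root downwards). -/
abbrev ACTVar (ι : Type) (k : ℕ) : Type := ι ⊕ Fin k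

/-- The expressions that may label a computation node with `k` computation nodes above it. There
are no constants. -/
inductive ACTExpr (ι : Type) (k : ℕ) : Type
  | add (u w : ACTVar ι k)
  | sub (u w : ACTVar ι k)
  | mul (u w : ACTVar ι k)
  | div (u w : ACTVar ι k)
  | sqrt (u : ACTVar ι k)

/-- `ACT ι k` is the type of (sub)trees of algebraic computation trees with real inputs `x_i`,
`i : ι`, hanging below exactly `k` computation nodes. A complete tree is an element of
`ACT ι 0`. -/
inductive ACT (ι : Type) : ℕ → Type
  /-- A leaf, which names the variable that holds the answer. -/
  | leaf {k : ℕ} (u : ACTVar ι k) : ACT ι k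
  /-- A computation node `y = e`, with one child. -/
  | compute {k : ℕ} (e : ACTExpr ι k) (t : ACT ι (k + 1)) : ACT ι k
  /-- A branch node that tests `y_u = 0`. -/
  | branchZero {k : ℕ} (u : ACTVar ι k) (yes no : ACT ι k) : ACT ι k
  /-- A branch node that tests `y_u > 0`. -/
  | branchPos {k : ℕ} (u : ACTVar ι k) (yes no : ACT ι k) : ACT ι k

/-- The value of an expression, given the values of the variables. It is undefined (`none`) for a
division by zero and for the square root of a negative number. -/
noncomputable def ACTExpr.eval {ι : Type} {k : ℕ} (y : ACTVar ι k → ℝ) :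
    ACTExpr ι k → Option ℝ
  | .add u w => some (y u + y w)
  | .sub u w => some (y u - y w)
  | .mul u w => some (y u * y w)
  | .div u w => if y w = 0 then none else some (y u / y w)
  | .sqrt u => if y u < 0 then none else some (Real.sqrt (y u))

/-- The answer found at the leaf that is reached on input `x`, where `y` lists the values of the
computation nodes passed so far; undefined (`none`) if an undefined operation is met on the way. -/
noncomputable def ACT.eval {ι : Type} (x : ι → ℝ) :
    {k : ℕ} → ACT ι k → (Fin k → ℝ) → Option ℝ
  | _, .leaf u, y => some (Sum.elim x y u)
  | _, .compute e t, y =>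
      (e.eval (Sum.elim x y)).bind fun v => t.eval x (Fin.snoc (α := fun _ => ℝ) y v)
  | _, .branchZero u yes no, y =>
      if Sum.elim x y u = 0 then yes.eval x y else no.eval x y
  | _, .branchPos u yes no, y =>
      if 0 < Sum.elim x y u then yes.eval x y else no.eval x y

/-- The result of a complete tree on input `x`. -/
noncomputable def ACT.run {ι : Type} (T : ACT ι 0) (x : ι → ℝ) : Option ℝ :=
  T.eval x Fin.elim0

/-- The depth: the largest number of computation and branch nodes on a path from the root to a
leaf. -/
def ACT.depth {ι : Type} : {k : ℕ} → ACT ι k → ℕ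
  | _, .leaf _ => 0
  | _, .compute _ t => t.depth + 1
  | _, .branchZero _ yes no => max yes.depth no.depth + 1
  | _, .branchPos _ yes no => max yes.depth no.depth + 1

/-! ### The discrete Fréchet problem -/

/-- The Euclidean plane. -/
abbrev Plane : Type := EuclideanSpace ℝ (Fin 2)

/-- The directed graph `G_δ` on the pairs `(p_i, q_j)` (given by their indices): there is an edge
from `(p_i, q_j)` to each of `(p_i, q_{j+1})`, `(p_{i+1}, q_j)`, `(p_{i+1}, q_{j+1})`, provided
that the two points are at distance at most `δ` in both pairs. -/
def frechetGraph {n : ℕ} (P Q : Fin n → Plane) (δ : ℝ) : Digraph (Fin n × Fin n) where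
  Adj a b :=
    ((b.1.val = a.1.val ∧ b.2.val = a.2.val + 1) ∨
      (b.1.val = a.1.val + 1 ∧ b.2.val = a.2.val) ∨
      (b.1.val = a.1.val + 1 ∧ b.2.val = a.2.val + 1)) ∧
    dist (P a.1) (Q a.2) ≤ δ ∧ dist (P b.1) (Q b.2) ≤ δ

/-- There is a path in `G_δ` from the first pair to the last pair. That the first pair is itself at
distance at most `δ` is implied by the edges as soon as there are at least two points; it is
written out for the sake of the path without edges, when `n = 1`. -/
def FrechetReachable {n : ℕ} [NeZero n] (P Q : Fin n → Plane) (δ : ℝ) : Prop :=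
  dist (P 0) (Q 0) ≤ δ ∧
    Relation.ReflTransGen (frechetGraph P Q δ).Adj (0, 0) (Fin.rev 0, Fin.rev 0)

/-- `δ` is the discrete Fréchet distance of `P` and `Q`: the smallest `δ` for which there is a path
in `G_δ` from the first pair to the last pair. -/
def IsDiscreteFrechetDist {n : ℕ} [NeZero n] (P Q : Fin n → Plane) (δ : ℝ) : Prop :=
  IsLeast {δ : ℝ | FrechetReachable P Q δ} δ

/-- The names of the `4 n` real inputs: `inl (i, c)` is the `c`-th coordinate of `p_i`, and
`inr (i, c)` is the `c`-th coordinate of `q_i`. -/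
abbrev FrechetVar (n : ℕ) : Type := (Fin n × Fin 2) ⊕ (Fin n × Fin 2)

/-- The coordinates of the points of `P` and `Q`, as the input of a tree. -/
def frechetInput {n : ℕ} (P Q : Fin n → Plane) : FrechetVar n → ℝ :=
  Sum.elim (fun a => P a.1 a.2) (fun a => Q a.1 a.2)

/-- The tree `T` solves the discrete Fréchet problem for sequences of `n` points: on every input,
the computation is well defined and its answer is the discrete Fréchet distance. -/
def ACT.SolvesDiscreteFrechet {n : ℕ} [NeZero n] (T : ACT (FrechetVar n) 0) : Prop :=
  ∀ P Q : Fin n → Plane, ∃ δ : ℝ,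
    T.run (frechetInput P Q) = some δ ∧ IsDiscreteFrechetDist P Q δ

/-! Only operations and tests on real numbers are charged for. Whatever is the same for all inputs
that reach a node is known there for free, however hard it is to compute; `SignConst` expresses this
for signs. In particular, once the signs of all `|p_i - q_j|² - t` are fixed, so is the existence of
a path for the threshold `t`, at no cost (`determinedByOrder_sqFrechet`). It remains to find these
`n²` signs for a given `t`, and to search for the right `t` among the `n²` squared distances, both
with about `n^(3/2)` nodes.

Signs for a given `t`: divide the `n` circles of squared radius `t` around the `q_j` into about `√n`
groups of about `√n`. Each pair of circles in a group has at most nine critical abscissas between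
which the vertical order of its arcs cannot change (`Reach.arcPair`). Sorting the `O(n)` critical
values of a group cuts the plane into slabs with fixed order; each `p_i` is then located by one
binary search for its slab and one among the arcs there (`Reach.locate`). A group costs `O(n log
n)`, hence `D = O(n^(3/2) log n)` for all groups (`Reach.incidences_fin`).

Search for `t`: the set of indices whose values lie strictly between two given values is found by a
tree of depth `O(D)`, so for each of the `O(n⁴)` choices of bounds at most `2^O(D)` sets occur over
all inputs (`Reach.encard_image_le`). Hence `O(D)` indices, fixed in advance, hit every such set
that contains about half of the remaining candidates (`Finset.exists_hitting_set`,
`Comparable.exists_net`). Sorting the values of these indices and locating the unknown among them by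
binary search halves the candidates (`Comparable.halve`); `O(log n)` rounds suffice
(`Comparable.find`). -/

/-! ### Trees as strategies

A node of a tree with inputs described by a point of `X` is represented by the set `K` of the real
functions on `X` that have been computed on the way to it, and the set `A` of the points whose path
passes through it. -/

/-- `Reach Φ d K A`: below a node at which the functions in `K` are available and which is reached by
the points of `A`, one can hang a tree of depth at most `d` all of whose leaves satisfy `Φ`. -/
inductive Reach {X : Type} (Φ : Set (X → ℝ) → Set X → Prop) : ℕ → Set (X → ℝ) → Set X → Prop
  | done {d K A} : Φ K A → Reach Φ d K A
  | add {d K A f g} : f ∈ K → g ∈ K → Reach Φ d (insert (fun x => f x + g x) K) A →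
      Reach Φ (d + 1) K A
  | sub {d K A f g} : f ∈ K → g ∈ K → Reach Φ d (insert (fun x => f x - g x) K) A →
      Reach Φ (d + 1) K A
  | mul {d K A f g} : f ∈ K → g ∈ K → Reach Φ d (insert (fun x => f x * g x) K) A →
      Reach Φ (d + 1) K A
  | div {d K A f g} : f ∈ K → g ∈ K → (∀ x ∈ A, g x ≠ 0) →
      Reach Φ d (insert (fun x => f x / g x) K) A → Reach Φ (d + 1) K A
  | sqrt {d K A f} : f ∈ K → (∀ x ∈ A, 0 ≤ f x) →
      Reach Φ d (insert (fun x => Real.sqrt (f x)) K) A → Reach Φ (d + 1) K A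
  | zero {d K A f} : f ∈ K → Reach Φ d K (A ∩ {x | f x = 0}) → Reach Φ d K (A ∩ {x | f x ≠ 0}) →
      Reach Φ (d + 1) K A
  | pos {d K A f} : f ∈ K → Reach Φ d K (A ∩ {x | 0 < f x}) → Reach Φ d K (A ∩ {x | ¬ 0 < f x}) →
      Reach Φ (d + 1) K A

namespace Reach

variable {X : Type} {Φ Ψ : Set (X → ℝ) → Set X → Prop} {K : Set (X → ℝ)} {A : Set X} {d d' : ℕ}

theorem mono_depth (h : Reach Φ d K A) : ∀ {d'}, d ≤ d' → Reach Φ d' K A := by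
  induction h with
  | done h => exact fun _ => .done h
  | add hf hg _ ih =>
    intro d' hd
    obtain ⟨e, rfl⟩ : ∃ e, d' = e + 1 := ⟨d' - 1, by omega⟩
    exact .add hf hg (ih (by omega))
  | sub hf hg _ ih =>
    intro d' hd
    obtain ⟨e, rfl⟩ : ∃ e, d' = e + 1 := ⟨d' - 1, by omega⟩
    exact .sub hf hg (ih (by omega))
  | mul hf hg _ ih =>
    intro d' hd
    obtain ⟨e, rfl⟩ : ∃ e, d' = e + 1 := ⟨d' - 1, by omega⟩
    exact .mul hf hg (ih (by omega))
  | div hf hg h0 _ ih =>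
    intro d' hd
    obtain ⟨e, rfl⟩ : ∃ e, d' = e + 1 := ⟨d' - 1, by omega⟩
    exact .div hf hg h0 (ih (by omega))
  | sqrt hf h0 _ ih =>
    intro d' hd
    obtain ⟨e, rfl⟩ : ∃ e, d' = e + 1 := ⟨d' - 1, by omega⟩
    exact .sqrt hf h0 (ih (by omega))
  | zero hf _ _ ih1 ih2 =>
    intro d' hd
    obtain ⟨e, rfl⟩ : ∃ e, d' = e + 1 := ⟨d' - 1, by omega⟩
    exact .zero hf (ih1 (by omega)) (ih2 (by omega))
  | pos hf _ _ ih1 ih2 =>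
    intro d' hd
    obtain ⟨e, rfl⟩ : ∃ e, d' = e + 1 := ⟨d' - 1, by omega⟩
    exact .pos hf (ih1 (by omega)) (ih2 (by omega))

/-- Grafting: a tree of depth `d'` is hung below every leaf. The continuation may depend on the
leaf, so it may use everything learnt on the way there. -/
theorem bind (h : Reach Φ d K A)
    (hΨ : ∀ K' A', K ⊆ K' → A' ⊆ A → Φ K' A' → Reach Ψ d' K' A') : Reach Ψ (d + d') K A := by
  induction h with
  | done h => exact (hΨ _ _ subset_rfl subset_rfl h).mono_depth (by omega)
  | add hf hg _ ih =>
    rw [Nat.add_right_comm]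
    exact .add hf hg (ih fun K' A' hK => hΨ K' A' ((Set.subset_insert _ _).trans hK))
  | sub hf hg _ ih =>
    rw [Nat.add_right_comm]
    exact .sub hf hg (ih fun K' A' hK => hΨ K' A' ((Set.subset_insert _ _).trans hK))
  | mul hf hg _ ih =>
    rw [Nat.add_right_comm]
    exact .mul hf hg (ih fun K' A' hK => hΨ K' A' ((Set.subset_insert _ _).trans hK))
  | div hf hg h0 _ ih =>
    rw [Nat.add_right_comm]
    exact .div hf hg h0 (ih fun K' A' hK => hΨ K' A' ((Set.subset_insert _ _).trans hK))
  | sqrt hf h0 _ ih =>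
    rw [Nat.add_right_comm]
    exact .sqrt hf h0 (ih fun K' A' hK => hΨ K' A' ((Set.subset_insert _ _).trans hK))
  | zero hf _ _ ih1 ih2 =>
    rw [Nat.add_right_comm]
    exact .zero hf (ih1 fun K' A' hK hA => hΨ K' A' hK (hA.trans Set.inter_subset_left))
      (ih2 fun K' A' hK hA => hΨ K' A' hK (hA.trans Set.inter_subset_left))
  | pos hf _ _ ih1 ih2 =>
    rw [Nat.add_right_comm]
    exact .pos hf (ih1 fun K' A' hK hA => hΨ K' A' hK (hA.trans Set.inter_subset_left))
      (ih2 fun K' A' hK hA => hΨ K' A' hK (hA.trans Set.inter_subset_left))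

theorem imp (h : Reach Φ d K A) (hΨ : ∀ K' A', K ⊆ K' → A' ⊆ A → Φ K' A' → Ψ K' A') :
    Reach Ψ d K A :=
  h.bind (d' := 0) fun K' A' hK hA hΦ => .done (hΨ K' A' hK hA hΦ)

/-- Tasks whose results persist can be performed one after the other. -/
theorem forall_finset {β : Type*} (s : Finset β) (c : ℕ) {Φ : β → Set (X → ℝ) → Set X → Prop}
    (hΦ : ∀ b K A K' A', K ⊆ K' → A' ⊆ A → Φ b K A → Φ b K' A')
    (h : ∀ b ∈ s, ∀ K' A', K ⊆ K' → A' ⊆ A → Reach (Φ b) c K' A') :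
    Reach (fun K' A' => ∀ b ∈ s, Φ b K' A') (s.card * c) K A := by
  classical
  induction s using Finset.induction_on with
  | empty => exact .done (by simp)
  | insert b s hb ih =>
    rw [Finset.card_insert_of_notMem hb, Nat.add_mul, one_mul]
    refine (ih fun b' hb' => h b' (Finset.mem_insert_of_mem hb')).bind fun K' A' hK hA h1 =>
      (h b (Finset.mem_insert_self _ _) K' A' hK hA).imp fun K'' A'' hK' hA' h2 b' hb' => ?_
    rcases Finset.mem_insert.1 hb' with rfl | hb'
    · exact h2
    · exact hΦ b' _ _ _ _ hK' hA' (h1 b' hb')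

/-- A tree of depth `d` tells at most `2 ^ d` cases apart. -/
theorem encard_image_le {β : Type*} (F : X → β) (h : Reach Φ d K A)
    (hF : ∀ K' A', Φ K' A' → ∀ x ∈ A', ∀ y ∈ A', F x = F y) : (F '' A).encard ≤ 2 ^ d := by
  induction h with
  | @done d K A h =>
    refine le_trans ?_ (one_le_pow₀ (one_le_two : (1 : ℕ∞) ≤ 2) : (1 : ℕ∞) ≤ 2 ^ d)
    rw [Set.encard_le_one_iff]
    rintro _ _ ⟨x, hx, rfl⟩ ⟨y, hy, rfl⟩
    exact hF _ _ h x hx y hy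
  | @add d _ _ _ _ _ _ _ ih => exact ih.trans (pow_le_pow_right₀ one_le_two (Nat.le_succ d))
  | @sub d _ _ _ _ _ _ _ ih => exact ih.trans (pow_le_pow_right₀ one_le_two (Nat.le_succ d))
  | @mul d _ _ _ _ _ _ _ ih => exact ih.trans (pow_le_pow_right₀ one_le_two (Nat.le_succ d))
  | @div d _ _ _ _ _ _ _ _ ih => exact ih.trans (pow_le_pow_right₀ one_le_two (Nat.le_succ d))
  | @sqrt d _ _ _ _ _ _ ih => exact ih.trans (pow_le_pow_right₀ one_le_two (Nat.le_succ d))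
  | @zero d K A f _ _ _ ih1 ih2 =>
    have hA : A = (A ∩ {x | f x = 0}) ∪ (A ∩ {x | f x ≠ 0}) := (Set.inter_union_compl A _).symm
    rw [hA, Set.image_union, pow_succ, mul_two]
    exact (Set.encard_union_le _ _).trans (add_le_add ih1 ih2)
  | @pos d K A f _ _ _ ih1 ih2 =>
    have hA : A = (A ∩ {x | 0 < f x}) ∪ (A ∩ {x | ¬ 0 < f x}) := (Set.inter_union_compl A _).symm
    rw [hA, Set.image_union, pow_succ, mul_two]
    exact (Set.encard_union_le _ _).trans (add_le_add ih1 ih2)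

end Reach

/-! ### From strategies to algebraic computation trees -/

section ToTree

variable {X ι : Type} (inp : X → ι → ℝ) (Spec : X → ℝ → Prop)

/-- `u` is a variable that holds the value of `f` on `A`. -/
def HoldsVar {k : ℕ} (Y : X → Fin k → ℝ) (A : Set X) (f : X → ℝ) (u : ACTVar ι k) : Prop :=
  ∀ x ∈ A, Sum.elim (inp x) (Y x) u = f x

variable {inp} in
theorem HoldsVar.snoc {k : ℕ} {Y : X → Fin k → ℝ} {A : Set X} {f : X → ℝ} {u : ACTVar ι k}
    (h : HoldsVar inp Y A f u) (v : X → ℝ) :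
    ∃ u', HoldsVar inp (fun x => Fin.snoc (α := fun _ => ℝ) (Y x) (v x)) A f u' := by
  cases u with
  | inl i => exact ⟨.inl i, fun x hx => h x hx⟩
  | inr j => exact ⟨.inr j.castSucc, fun x hx => by simpa using h x hx⟩

variable {inp} in
theorem HoldsVar.insert_snoc {k : ℕ} {Y : X → Fin k → ℝ} {A : Set X} {K : Set (X → ℝ)}
    (hY : ∀ f ∈ K, ∃ u, HoldsVar inp Y A f u) (v : X → ℝ) :
    ∀ f ∈ insert v K,
      ∃ u, HoldsVar inp (fun x => Fin.snoc (α := fun _ => ℝ) (Y x) (v x)) A f u := by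
  intro f hf
  rcases Set.mem_insert_iff.1 hf with rfl | hf
  · exact ⟨.inr (Fin.last k), fun x _ => by simp⟩
  · obtain ⟨u, hu⟩ := hY f hf
    exact hu.snoc v

/-- Induction on the strategy. The invariant is that one and the same variable holds an available
function at all inputs that reach the node; the side conditions on divisions and square roots are
needed only for these inputs. -/
theorem Reach.exists_act {d : ℕ} {K : Set (X → ℝ)} {A : Set X}
    (h : Reach (fun K' A' => ∃ f ∈ K', ∀ x ∈ A', Spec x (f x)) d K A) :
    ∀ {k : ℕ} (Y : X → Fin k → ℝ), (∀ f ∈ K, ∃ u, HoldsVar inp Y A f u) →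
      ∃ T : ACT ι k, T.depth ≤ d ∧ ∀ x ∈ A, ∃ r, T.eval (inp x) (Y x) = some r ∧ Spec x r := by
  have key : ∀ {k d : ℕ} {A : Set X} {Y : X → Fin k → ℝ} (v : X → ℝ) (e : ACTExpr ι k),
      (∀ x ∈ A, e.eval (Sum.elim (inp x) (Y x)) = some (v x)) →
      (∃ T : ACT ι (k + 1), T.depth ≤ d ∧ ∀ x ∈ A, ∃ r,
        T.eval (inp x) (Fin.snoc (α := fun _ => ℝ) (Y x) (v x)) = some r ∧ Spec x r) →
      ∃ T : ACT ι k, T.depth ≤ d + 1 ∧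
        ∀ x ∈ A, ∃ r, T.eval (inp x) (Y x) = some r ∧ Spec x r := by
    rintro k d A Y v e he ⟨T, hT, hr⟩
    refine ⟨.compute e T, by simpa [ACT.depth] using hT, fun x hx => ?_⟩
    simpa [ACT.eval, he x hx] using hr x hx
  have sub : ∀ {k : ℕ} {A B : Set X} {Y : X → Fin k → ℝ} {K : Set (X → ℝ)},
      (∀ f ∈ K, ∃ u, HoldsVar inp Y A f u) → ∀ f ∈ K, ∃ u, HoldsVar inp Y (A ∩ B) f u :=
    fun hY f hf => (hY f hf).imp fun u hu x hx => hu x hx.1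
  induction h with
  | done h =>
    intro k Y hY
    obtain ⟨f, hf, hs⟩ := h
    obtain ⟨u, hu⟩ := hY f hf
    exact ⟨.leaf u, Nat.zero_le _, fun x hx => ⟨f x, by simp [ACT.eval, hu x hx], hs x hx⟩⟩
  | add hf hg _ ih =>
    intro k Y hY
    obtain ⟨u, hu⟩ := hY _ hf
    obtain ⟨w, hw⟩ := hY _ hg
    exact key _ (.add u w) (fun x hx => by simp [ACTExpr.eval, hu x hx, hw x hx])
      (ih _ (HoldsVar.insert_snoc hY _))
  | sub hf hg _ ih =>
    intro k Y hY
    obtain ⟨u, hu⟩ := hY _ hf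
    obtain ⟨w, hw⟩ := hY _ hg
    exact key _ (.sub u w) (fun x hx => by simp [ACTExpr.eval, hu x hx, hw x hx])
      (ih _ (HoldsVar.insert_snoc hY _))
  | mul hf hg _ ih =>
    intro k Y hY
    obtain ⟨u, hu⟩ := hY _ hf
    obtain ⟨w, hw⟩ := hY _ hg
    exact key _ (.mul u w) (fun x hx => by simp [ACTExpr.eval, hu x hx, hw x hx])
      (ih _ (HoldsVar.insert_snoc hY _))
  | div hf hg h0 _ ih =>
    intro k Y hY
    obtain ⟨u, hu⟩ := hY _ hf
    obtain ⟨w, hw⟩ := hY _ hg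
    exact key _ (.div u w) (fun x hx => by simp [ACTExpr.eval, hu x hx, hw x hx, h0 x hx])
      (ih _ (HoldsVar.insert_snoc hY _))
  | sqrt hf h0 _ ih =>
    intro k Y hY
    obtain ⟨u, hu⟩ := hY _ hf
    exact key _ (.sqrt u) (fun x hx => by simp [ACTExpr.eval, hu x hx, h0 x hx])
      (ih _ (HoldsVar.insert_snoc hY _))
  | @zero d K A f hf _ _ ih1 ih2 =>
    intro k Y hY
    obtain ⟨u, hu⟩ := hY _ hf
    obtain ⟨T1, hd1, h1⟩ := ih1 Y (sub hY)
    obtain ⟨T2, hd2, h2⟩ := ih2 Y (sub hY)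
    refine ⟨.branchZero u T1 T2, by simp [ACT.depth, hd1, hd2], fun x hx => ?_⟩
    by_cases h : f x = 0
    · simpa [ACT.eval, hu x hx, h] using h1 x ⟨hx, h⟩
    · simpa [ACT.eval, hu x hx, h] using h2 x ⟨hx, h⟩
  | @pos d K A f hf _ _ ih1 ih2 =>
    intro k Y hY
    obtain ⟨u, hu⟩ := hY _ hf
    obtain ⟨T1, hd1, h1⟩ := ih1 Y (sub hY)
    obtain ⟨T2, hd2, h2⟩ := ih2 Y (sub hY)
    refine ⟨.branchPos u T1 T2, by simp [ACT.depth, hd1, hd2], fun x hx => ?_⟩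
    by_cases h : 0 < f x
    · simpa only [ACT.eval, hu x hx, h, if_true] using h1 x ⟨hx, h⟩
    · simpa only [ACT.eval, hu x hx, h, if_false] using h2 x ⟨hx, h⟩

end ToTree

/-! ### Constant signs -/

/-- The sign of `f` is the same at all points of `A`. -/
def SignConst {X : Type} (A : Set X) (f : X → ℝ) : Prop :=
  ∀ x ∈ A, ∀ y ∈ A, SignType.sign (f x) = SignType.sign (f y)

/-- If `a` and `b` do not have opposite signs, their signs decide that of `a + b`. Otherwise `a - b`
has the sign of `a`, and `a² - b² = (a - b) (a + b)` yields the other factor. Used repeatedly, this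
removes square roots from the sign conditions on arcs. -/
theorem sign_add_eq_of_sign_sq_sub_sq {a b a' b' : ℝ}
    (ha : SignType.sign a = SignType.sign a') (hb : SignType.sign b = SignType.sign b')
    (h : SignType.sign (a ^ 2 - b ^ 2) = SignType.sign (a' ^ 2 - b' ^ 2)) :
    SignType.sign (a + b) = SignType.sign (a' + b') := by
  rcases lt_trichotomy 0 a with h1 | h1 | h1
  · have h1' : 0 < a' := by rwa [sign_pos h1, eq_comm, sign_eq_one_iff] at ha
    rcases lt_or_ge b 0 with h2 | h2
    · have h2' : b' < 0 := by rwa [sign_neg h2, eq_comm, sign_eq_neg_one_iff] at hb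
      have e : a ^ 2 - b ^ 2 = (a - b) * (a + b) := by ring
      have e' : a' ^ 2 - b' ^ 2 = (a' - b') * (a' + b') := by ring
      rwa [e, e', sign_mul, sign_mul, sign_pos (by linarith : 0 < a - b),
        sign_pos (by linarith : 0 < a' - b'), one_mul, one_mul] at h
    · have h2' : 0 ≤ b' := by
        by_contra hc
        rw [sign_neg (not_le.1 hc), sign_eq_neg_one_iff] at hb
        linarith
      rw [sign_pos (by linarith), sign_pos (by linarith)]
  · have h1' : a' = 0 := by rwa [← h1, sign_zero, eq_comm, sign_eq_zero_iff] at ha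
    rw [← h1, h1', zero_add, zero_add, hb]
  · have h1' : a' < 0 := by rwa [sign_neg h1, eq_comm, sign_eq_neg_one_iff] at ha
    rcases lt_or_ge 0 b with h2 | h2
    · have h2' : 0 < b' := by rwa [sign_pos h2, eq_comm, sign_eq_one_iff] at hb
      have e : a ^ 2 - b ^ 2 = (a - b) * (a + b) := by ring
      have e' : a' ^ 2 - b' ^ 2 = (a' - b') * (a' + b') := by ring
      rw [e, e', sign_mul, sign_mul, sign_neg (by linarith : a - b < 0),
        sign_neg (by linarith : a' - b' < 0)] at h
      revert h
      generalize SignType.sign (a + b) = s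
      generalize SignType.sign (a' + b') = s'
      revert s s'
      decide
    · have h2' : b' ≤ 0 := by
        by_contra hc
        rw [sign_pos (not_le.1 hc), sign_eq_one_iff] at hb
        linarith
      rw [sign_neg (by linarith), sign_neg (by linarith)]

namespace SignConst

variable {X : Type} {A B : Set X} {f g : X → ℝ}

theorem mono (h : SignConst A f) (hB : B ⊆ A) : SignConst B f :=
  fun x hx y hy => h x (hB hx) y (hB hy)

theorem congr (h : SignConst A f) (hfg : ∀ x ∈ A, f x = g x) : SignConst A g := by
  intro x hx y hy
  rw [← hfg x hx, ← hfg y hy]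
  exact h x hx y hy

theorem const (r : ℝ) : SignConst A fun _ => r := fun _ _ _ _ => rfl

theorem mul (hf : SignConst A f) (hg : SignConst A g) : SignConst A fun x => f x * g x := by
  intro x hx y hy
  simp only [sign_mul, hf x hx y hy, hg x hx y hy]

theorem neg (hf : SignConst A f) : SignConst A fun x => -f x :=
  ((const (-1)).mul hf).congr fun x _ => by ring

theorem sub_comm (h : SignConst A fun x => f x - g x) : SignConst A fun x => g x - f x :=
  h.neg.congr fun x _ => by ring

theorem add_of_sq_sub_sq (hf : SignConst A f) (hg : SignConst A g)
    (h : SignConst A fun x => f x ^ 2 - g x ^ 2) : SignConst A fun x => f x + g x :=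
  fun x hx y hy => sign_add_eq_of_sign_sq_sub_sq (hf x hx y hy) (hg x hx y hy) (h x hx y hy)

theorem of_pos (h : ∀ x ∈ A, 0 < f x) : SignConst A f := by
  intro x hx y hy
  rw [sign_pos (h x hx), sign_pos (h y hy)]

theorem of_neg (h : ∀ x ∈ A, f x < 0) : SignConst A f := by
  intro x hx y hy
  rw [sign_neg (h x hx), sign_neg (h y hy)]

theorem of_eq_zero (h : ∀ x ∈ A, f x = 0) : SignConst A f := by
  intro x hx y hy
  rw [h x hx, h y hy]

theorem sqrt (hf : SignConst A f) (h0 : ∀ x ∈ A, 0 ≤ f x) :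
    SignConst A fun x => Real.sqrt (f x) := by
  have key : ∀ r : ℝ, 0 ≤ r → SignType.sign (Real.sqrt r) = SignType.sign r := by
    intro r hr
    rcases hr.eq_or_lt with rfl | hr
    · simp
    · rw [sign_pos hr, sign_pos (Real.sqrt_pos.2 hr)]
  intro x hx y hy
  show SignType.sign (Real.sqrt (f x)) = SignType.sign (Real.sqrt (f y))
  rw [key _ (h0 x hx), key _ (h0 y hy)]
  exact hf x hx y hy

theorem pos_iff (h : SignConst A f) {x y : X} (hx : x ∈ A) (hy : y ∈ A) : 0 < f x ↔ 0 < f y := by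
  rw [← sign_eq_one_iff, ← sign_eq_one_iff, h x hx y hy]

theorem neg_iff (h : SignConst A f) {x y : X} (hx : x ∈ A) (hy : y ∈ A) : f x < 0 ↔ f y < 0 := by
  rw [← sign_eq_neg_one_iff, ← sign_eq_neg_one_iff, h x hx y hy]

theorem eq_zero_iff (h : SignConst A f) {x y : X} (hx : x ∈ A) (hy : y ∈ A) :
    f x = 0 ↔ f y = 0 := by
  rw [← sign_eq_zero_iff, h x hx y hy, sign_eq_zero_iff]

theorem cases (h : SignConst A f) :
    (∀ x ∈ A, 0 < f x) ∨ (∀ x ∈ A, f x = 0) ∨ (∀ x ∈ A, f x < 0) := by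
  rcases A.eq_empty_or_nonempty with rfl | ⟨y, hy⟩
  · exact .inl fun x hx => absurd hx (Set.notMem_empty x)
  rcases lt_trichotomy (f y) 0 with h1 | h1 | h1
  · exact .inr (.inr fun x hx => (h.neg_iff hx hy).2 h1)
  · exact .inr (.inl fun x hx => (h.eq_zero_iff hx hy).2 h1)
  · exact .inl fun x hx => (h.pos_iff hx hy).2 h1

theorem lt_iff (h : SignConst A fun x => f x - g x) {x y : X} (hx : x ∈ A) (hy : y ∈ A) :
    f x < g x ↔ f y < g y := by
  simpa using h.neg_iff hx hy

theorem gt_iff (h : SignConst A fun x => f x - g x) {x y : X} (hx : x ∈ A) (hy : y ∈ A) :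
    g x < f x ↔ g y < f y := by
  simpa using h.pos_iff hx hy

theorem le_iff (h : SignConst A fun x => f x - g x) {x y : X} (hx : x ∈ A) (hy : y ∈ A) :
    f x ≤ g x ↔ f y ≤ g y := by
  rw [← not_lt, ← not_lt, h.gt_iff hx hy]

theorem eq_iff (h : SignConst A fun x => f x - g x) {x y : X} (hx : x ∈ A) (hy : y ∈ A) :
    f x = g x ↔ f y = g y := by
  simpa [sub_eq_zero] using h.eq_zero_iff hx hy

end SignConst

/-! ### Arithmetic and tests -/

/-- `f` can be computed from the functions in `K` with `d` additions, subtractions and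
multiplications. -/
inductive Arith {X : Type} (K : Set (X → ℝ)) : ℕ → (X → ℝ) → Prop
  | mem {f} : f ∈ K → Arith K 0 f
  | add {d e f g} : Arith K d f → Arith K e g → Arith K (d + e + 1) fun x => f x + g x
  | sub {d e f g} : Arith K d f → Arith K e g → Arith K (d + e + 1) fun x => f x - g x
  | mul {d e f g} : Arith K d f → Arith K e g → Arith K (d + e + 1) fun x => f x * g x

namespace Arith

variable {X : Type} {K K' : Set (X → ℝ)} {A : Set X} {d : ℕ} {f g : X → ℝ}

theorem mono (h : Arith K d f) (hK : K ⊆ K') : Arith K' d f := by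
  induction h with
  | mem h => exact .mem (hK h)
  | add _ _ h1 h2 => exact .add h1 h2
  | sub _ _ h1 h2 => exact .sub h1 h2
  | mul _ _ h1 h2 => exact .mul h1 h2

theorem sq (h : Arith K d f) : Arith K (d + d + 1) fun x => f x ^ 2 := by
  simpa only [pow_two] using h.mul h

theorem reach (h : Arith K d f) : ∀ {K' : Set (X → ℝ)} {A : Set X}, K ⊆ K' →
    Reach (fun K'' _ => f ∈ K'') d K' A := by
  induction h with
  | mem h => exact fun hK => .done (hK h)
  | add _ _ h1 h2 =>
    exact fun hK => ((h1 hK).bind fun K1 _ hK1 _ hf => (h2 (hK.trans hK1)).bind (d' := 1)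
      fun K2 _ hK2 _ hg => .add (hK2 hf) hg (.done (Set.mem_insert _ _))).mono_depth (by omega)
  | sub _ _ h1 h2 =>
    exact fun hK => ((h1 hK).bind fun K1 _ hK1 _ hf => (h2 (hK.trans hK1)).bind (d' := 1)
      fun K2 _ hK2 _ hg => .sub (hK2 hf) hg (.done (Set.mem_insert _ _))).mono_depth (by omega)
  | mul _ _ h1 h2 =>
    exact fun hK => ((h1 hK).bind fun K1 _ hK1 _ hf => (h2 (hK.trans hK1)).bind (d' := 1)
      fun K2 _ hK2 _ hg => .mul (hK2 hf) hg (.done (Set.mem_insert _ _))).mono_depth (by omega)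

end Arith

namespace Reach

variable {X : Type} {K : Set (X → ℝ)} {A : Set X} {d : ℕ} {f g : X → ℝ}

theorem sign_of_mem (hf : f ∈ K) : Reach (fun _ A' => SignConst A' f) 2 K A :=
  .zero hf (.done (.of_eq_zero fun _ hx => hx.2))
    (.pos hf (.done (.of_pos fun _ hx => hx.2))
      (.done (.of_neg fun _ hx => lt_of_le_of_ne (not_lt.1 hx.2) hx.1.2)))

theorem sign_of_arith (hf : Arith K d f) : Reach (fun _ A' => SignConst A' f) (d + 2) K A :=
  (hf.reach subset_rfl).bind fun _ _ _ _ h => sign_of_mem h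

theorem sqrt_of_arith (hf : Arith K d f) (h0 : ∀ x ∈ A, 0 ≤ f x) :
    Reach (fun K' _ => (fun x => Real.sqrt (f x)) ∈ K') (d + 1) K A :=
  (hf.reach subset_rfl).bind fun _ _ _ hA h =>
    .sqrt h (fun x hx => h0 x (hA hx)) (.done (Set.mem_insert _ _))

theorem div_of_arith {e : ℕ} (hf : Arith K d f) (hg : Arith K e g) (h0 : ∀ x ∈ A, g x ≠ 0) :
    Reach (fun K' _ => (fun x => f x / g x) ∈ K') (d + e + 1) K A :=
  ((hf.reach subset_rfl).bind fun _ _ hK hA h => (hg.reach hK).bind (d' := 1)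
    fun _ _ hK' hA' h' => .div (hK' h) h' (fun x hx => h0 x (hA (hA' hx)))
      (.done (Set.mem_insert _ _))).mono_depth (by omega)

end Reach

/-! ### Binary search and sorting -/

theorem Finset.exists_median {β : Type*} (s : Finset β) (hs : s.Nonempty) (v : β → ℝ) :
    ∃ m ∈ s, 2 * (s.filter fun i => v i < v m).card ≤ s.card ∧
      2 * (s.filter fun i => v m < v i).card ≤ s.card := by
  classical
  obtain ⟨i0, hi0, hmin⟩ := s.exists_min_image v hs
  have hne : (s.filter fun m => 2 * (s.filter fun i => v i < v m).card ≤ s.card).Nonempty := by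
    refine ⟨i0, Finset.mem_filter.2 ⟨hi0, ?_⟩⟩
    rw [Finset.filter_false_of_mem fun i hi => not_lt.2 (hmin i hi)]
    simp
  -- Take the largest value with at most half of the elements below it. If more than half were
  -- above, the next larger value would also qualify.
  obtain ⟨m, hm, hmax⟩ := Finset.exists_max_image _ v hne
  rw [Finset.mem_filter] at hm
  refine ⟨m, hm.1, hm.2, ?_⟩
  by_contra hc
  have hne' : (s.filter fun i => v m < v i).Nonempty := by
    rw [Finset.nonempty_iff_ne_empty]
    intro h
    simp [h] at hc
  obtain ⟨m', hm', hmin'⟩ := Finset.exists_min_image _ v hne'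
  rw [Finset.mem_filter] at hm'
  have hsub : (s.filter fun i => v i < v m') ⊆ s \ (s.filter fun i => v m < v i) := by
    intro i hi
    rw [Finset.mem_filter] at hi
    refine Finset.mem_sdiff.2 ⟨hi.1, fun h => ?_⟩
    exact absurd hi.2 (not_lt.2 (hmin' i h))
  have hcard := Finset.card_le_card hsub
  rw [Finset.card_sdiff_of_subset (Finset.filter_subset _ _)] at hcard
  have := hmax m' (Finset.mem_filter.2 ⟨hm'.1, by omega⟩)
  exact absurd hm'.2 (not_lt.2 this)

namespace Reach

variable {X : Type} {K : Set (X → ℝ)} {A : Set X} {β : Type*}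

/-- Binary search for `h` among functions whose order is known. -/
theorem search {f : β → X → ℝ} {h : X → ℝ} {c : ℕ} : ∀ {k : ℕ} {s : Finset β}
    {K : Set (X → ℝ)} {A : Set X}, s.card < 2 ^ k →
    (∀ i ∈ s, ∀ j ∈ s, SignConst A fun x => f i x - f j x) →
    (∀ i ∈ s, ∀ K' A', K ⊆ K' → A' ⊆ A → Reach (fun _ B => SignConst B fun x => h x - f i x) c K' A') →
    Reach (fun _ B => ∀ i ∈ s, SignConst B fun x => h x - f i x) (k * c) K A := by
  intro k
  induction k with
  | zero =>
    intro s K A hs _ _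
    have : s = ∅ := by simpa using hs
    exact .done (by simp [this])
  | succ k ih =>
    intro s K A hs hord htest
    rcases s.eq_empty_or_nonempty with rfl | hne
    · exact .done (by simp)
    rcases A.eq_empty_or_nonempty with rfl | ⟨x0, hx0⟩
    · exact .done fun _ _ x hx => absurd hx (Set.notMem_empty x)
    -- The order of the `f i` is constant on `A`, so the median at the sample input `x0` serves all
    -- inputs.
    obtain ⟨m, hm, hlo, hhi⟩ := s.exists_median hne fun i => f i x0
    rw [Nat.add_mul, one_mul, Nat.add_comm]
    refine (htest m hm K A subset_rfl subset_rfl).bind fun K' A' hK hA hm' => ?_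
    have step : ∀ (q : β → Prop) [DecidablePred q], 2 * (s.filter q).card ≤ s.card →
        (∀ i ∈ s, ¬ q i → SignConst A' fun x => h x - f i x) →
        Reach (fun _ B => ∀ i ∈ s, SignConst B fun x => h x - f i x) (k * c) K' A' := by
      intro q _ hq hrest
      refine (ih (s := s.filter q) (by rw [pow_succ] at hs; omega)
        (fun i hi j hj => (hord i (Finset.mem_filter.1 hi).1 j (Finset.mem_filter.1 hj).1).mono hA)
        (fun i hi K'' A'' hK' hA' => htest i (Finset.mem_filter.1 hi).1 K'' A'' (hK.trans hK')
          (hA'.trans hA))).imp fun K'' A'' hK' hA' h1 i hi => ?_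
      by_cases hqi : q i
      · exact h1 i (Finset.mem_filter.2 ⟨hi, hqi⟩)
      · exact (hrest i hi hqi).mono hA'
    rcases hm'.cases with h1 | h1 | h1
    · refine step _ hhi fun i hi hle => .of_pos fun x hx => ?_
      have := ((hord m hm i hi).lt_iff hx0 (hA hx)).not.1 hle
      linarith [h1 x hx]
    · exact .done fun i hi => ((hord m hm i hi).mono hA).congr fun x hx => by linarith [h1 x hx]
    · refine step _ hlo fun i hi hle => .of_neg fun x hx => ?_
      have := ((hord i hi m hm).lt_iff hx0 (hA hx)).not.1 hle
      linarith [h1 x hx]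

/-- Sorting by insertion with binary search. -/
theorem sort {f : β → X → ℝ} {k : ℕ} {s : Finset β} (hs : s.card < 2 ^ k) (hf : ∀ i ∈ s, f i ∈ K) :
    Reach (fun _ B => ∀ i ∈ s, ∀ j ∈ s, SignConst B fun x => f i x - f j x)
      (s.card * (k * 3)) K A := by
  classical
  induction s using Finset.induction_on with
  | empty => exact .done (by simp)
  | insert b s hb ih =>
    rw [Finset.card_insert_of_notMem hb] at hs ⊢
    rw [Nat.add_mul, one_mul]
    refine (ih (by omega) fun i hi => hf i (Finset.mem_insert_of_mem hi)).bind
      fun K' A' hK hA h1 => ?_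
    refine (search (f := f) (h := f b) (c := 3) (by omega) h1 fun i hi K'' A'' hK' _ =>
      sign_of_arith (d := 1) ?_).imp fun K'' A'' hK' hA' h2 => ?_
    · exact .sub (.mem (hK' (hK (hf b (Finset.mem_insert_self _ _)))))
        (.mem (hK' (hK (hf i (Finset.mem_insert_of_mem hi)))))
    · intro i hi j hj
      rcases Finset.mem_insert.1 hi with rfl | his <;>
        rcases Finset.mem_insert.1 hj with rfl | hjs
      · exact .of_eq_zero fun x _ => sub_self _
      · exact h2 j hjs
      · exact (h2 i his).sub_comm
      · exact (h1 i his j hjs).mono hA'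

end Reach

/-! ### Critical values -/

/-- There are at most `N` available functions such that `P` holds for a function `z` as soon as the
position of `z` relative to all of them is known. -/
def Crit {X : Type} (N : ℕ) (P : Set X → (X → ℝ) → Prop) (K : Set (X → ℝ)) (A : Set X) : Prop :=
  ∃ S : Finset (X → ℝ), S.card ≤ N ∧ (∀ κ ∈ S, κ ∈ K) ∧
    ∀ B ⊆ A, ∀ z : X → ℝ, (∀ κ ∈ S, SignConst B fun x => z x - κ x) → P B z

namespace Crit

variable {X : Type} {N M : ℕ} {P Q : Set X → (X → ℝ) → Prop} {K K' : Set (X → ℝ)} {A A' : Set X}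

theorem mono (h : Crit N P K A) (hK : K ⊆ K') (hA : A' ⊆ A) : Crit N P K' A' := by
  obtain ⟨S, hS, hSK, hP⟩ := h
  exact ⟨S, hS, fun κ hκ => hK (hSK κ hκ), fun B hB => hP B (hB.trans hA)⟩

theorem imp (h : Crit N P K A) (hPQ : ∀ B ⊆ A, ∀ z, P B z → Q B z) : Crit N Q K A := by
  obtain ⟨S, hS, hSK, hP⟩ := h
  exact ⟨S, hS, hSK, fun B hB z hz => hPQ B hB z (hP B hB z hz)⟩

theorem and (h : Crit N P K A) (h' : Crit M Q K A) :
    Crit (N + M) (fun B z => P B z ∧ Q B z) K A := by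
  classical
  obtain ⟨S, hS, hSK, hP⟩ := h
  obtain ⟨T, hT, hTK, hQ⟩ := h'
  refine ⟨S ∪ T, (Finset.card_union_le S T).trans (add_le_add hS hT), fun κ hκ => ?_,
    fun B hB z hz => ⟨hP B hB z fun κ hκ => hz κ (Finset.mem_union_left _ hκ),
      hQ B hB z fun κ hκ => hz κ (Finset.mem_union_right _ hκ)⟩⟩
  rcases Finset.mem_union.1 hκ with h | h
  exacts [hSK κ h, hTK κ h]

theorem forall_finset {β : Type*} (s : Finset β) {P : β → Set X → (X → ℝ) → Prop}
    (h : ∀ b ∈ s, Crit N (P b) K A) : Crit (s.card * N) (fun B z => ∀ b ∈ s, P b B z) K A := by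
  classical
  induction s using Finset.induction_on with
  | empty => exact ⟨∅, by simp, by simp, by simp⟩
  | insert b s hb ih =>
    rw [Finset.card_insert_of_notMem hb, Nat.add_mul, one_mul]
    refine ((ih fun b' hb' => h b' (Finset.mem_insert_of_mem hb')).and
      (h b (Finset.mem_insert_self _ _))).imp fun B _ z hz b' hb' => ?_
    rcases Finset.mem_insert.1 hb' with rfl | hb'
    exacts [hz.2, hz.1 b' hb']

theorem linear {m : X → ℝ} (hm : m ∈ K) :
    Crit 1 (fun B z => SignConst B fun x => z x - m x) K A :=
  ⟨{m}, by simp, by simpa using hm, fun B _ z hz => hz m (by simp)⟩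

end Crit

/-- The critical values are the roots `m ± √γ`. If `γ < 0` the expression is positive for every `z`,
and none is needed. -/
theorem Reach.crit_sq {X : Type} {K : Set (X → ℝ)} {A : Set X} {m γ : X → ℝ} (hm : m ∈ K)
    (hγ : γ ∈ K) :
    Reach (Crit 2 fun B z => SignConst B fun x => (z x - m x) ^ 2 - γ x) 5 K A := by
  classical
  refine (Reach.sign_of_mem hγ).bind (d' := 3) fun K' A' hK hA h => ?_
  have hnn (h0 : ∀ x ∈ A', 0 ≤ γ x) :
      Reach (Crit 2 fun B z => SignConst B fun x => (z x - m x) ^ 2 - γ x) 3 K' A' := by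
    refine .sqrt (hK hγ) h0 (.add (Set.mem_insert_of_mem _ (hK hm)) (Set.mem_insert _ _)
      (.sub (Set.mem_insert_of_mem _ (Set.mem_insert_of_mem _ (hK hm)))
        (Set.mem_insert_of_mem _ (Set.mem_insert _ _)) (.done ?_)))
    refine ⟨{fun x => m x + Real.sqrt (γ x), fun x => m x - Real.sqrt (γ x)}, Finset.card_le_two,
      by simp, fun B hB z hz => ?_⟩
    refine ((hz (fun x => m x + Real.sqrt (γ x)) (by simp)).mul
      (hz (fun x => m x - Real.sqrt (γ x)) (by simp))).congr fun x hx => ?_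
    nlinarith [Real.sq_sqrt (h0 x (hB hx))]
  rcases h.cases with h | h | h
  · exact hnn fun x hx => (h x hx).le
  · exact hnn fun x hx => (h x hx).ge
  · exact .done ⟨∅, by simp, by simp, fun B hB z _ =>
      .of_pos fun x hx => by nlinarith [h x (hB hx), sq_nonneg (z x - m x)]⟩

/-! ### Circular arcs -/

/-- For `z = 2 x`, the vertical line at `x` meets the circles of squared radius `t` around `(a, b)`
and `(a', b')` in the same way all over `B`: the points of intersection with the two circles have
the same vertical order. -/
def ArcPair {X : Type} (a b a' b' t : X → ℝ) (B : Set X) (z : X → ℝ) : Prop :=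
  ∀ x : X → ℝ, (z = fun p => x p + x p) →
    (SignConst B fun p => t p - (x p - a p) ^ 2) ∧
    ((∀ p ∈ B, 0 ≤ t p - (x p - a p) ^ 2) → (∀ p ∈ B, 0 ≤ t p - (x p - a' p) ^ 2) →
      ∀ σ σ' : ℝ, σ ^ 2 = 1 → σ' ^ 2 = 1 → SignConst B fun p =>
        (b p + σ * Real.sqrt (t p - (x p - a p) ^ 2)) -
          (b' p + σ' * Real.sqrt (t p - (x p - a' p) ^ 2)))

/-- Write `c = b - b'`, with `w`, `w'` the two square roots. The sign of `c + (σ w - σ' w')` follows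
from those of `c`, of `σ w - σ' w'` and of the difference of their squares. For the second, `w² -
w'² = (a - a') (z - (a + a'))`. The third is `(c² - w² - w'²) + 2 σ σ' w w'`, to which the same
principle applies: `h4` gives the sign of the bracket, and `h5` that of `(c² - w² - w'²)² - 4 w²
w'²`, which vanishes where the full circles meet. Using `z = 2 x` avoids halves, since trees have no
constants. -/
theorem arcPair_of_signConst {X : Type} {a b a' b' t : X → ℝ} {B : Set X} {z : X → ℝ}
    (h1 : SignConst B fun p => (z p - (a p + a p)) ^ 2 - (t p + t p + (t p + t p)))
    (h2 : SignConst B fun p => (z p - (a' p + a' p)) ^ 2 - (t p + t p + (t p + t p)))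
    (hc : SignConst B fun p => b p - b' p) (he : SignConst B fun p => a p - a' p)
    (hm : SignConst B fun p => z p - (a p + a' p))
    (h4 : SignConst B fun p => (z p - (a p + a' p)) ^ 2 - (t p + t p + (t p + t p) -
      ((b p - b' p) ^ 2 + (b p - b' p) ^ 2 + (a p - a' p) ^ 2)))
    (h5 : SignConst B fun p => ((a p - a' p) ^ 2 + (b p - b' p) ^ 2) * (z p - (a p + a' p)) ^ 2 -
      (b p - b' p) ^ 2 * (t p + t p + (t p + t p) - ((a p - a' p) ^ 2 + (b p - b' p) ^ 2))) :
    ArcPair a b a' b' t B z := by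
  rintro x rfl
  have hw : SignConst B fun p => t p - (x p - a p) ^ 2 :=
    ((SignConst.const (-1 / 4)).mul h1).congr fun p _ => by ring
  have hw' : SignConst B fun p => t p - (x p - a' p) ^ 2 :=
    ((SignConst.const (-1 / 4)).mul h2).congr fun p _ => by ring
  refine ⟨hw, fun h0 h0' σ σ' hσ hσ' => ?_⟩
  have hs := hw.sqrt h0
  have hs' := hw'.sqrt h0'
  have hd : SignConst B fun p => σ * Real.sqrt (t p - (x p - a p) ^ 2) +
      -σ' * Real.sqrt (t p - (x p - a' p) ^ 2) := by
    refine ((SignConst.const σ).mul hs).add_of_sq_sub_sq ((SignConst.const (-σ')).mul hs')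
      ((he.mul hm).congr fun p hp => ?_)
    rw [mul_pow, mul_pow, neg_sq, hσ, hσ', Real.sq_sqrt (h0 p hp), Real.sq_sqrt (h0' p hp)]
    ring
  have hq : SignConst B fun p => ((b p - b' p) ^ 2 - (t p - (x p - a p) ^ 2) -
      (t p - (x p - a' p) ^ 2)) + 2 * σ * σ' * (Real.sqrt (t p - (x p - a p) ^ 2) *
      Real.sqrt (t p - (x p - a' p) ^ 2)) := by
    refine SignConst.add_of_sq_sub_sq (((SignConst.const (1 / 2)).mul h4).congr fun p _ => by ring)
      ((SignConst.const (2 * σ * σ')).mul (hs.mul hs')) (h5.congr fun p hp => ?_)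
    rw [mul_pow, mul_pow, mul_pow, mul_pow, hσ, hσ', Real.sq_sqrt (h0 p hp),
      Real.sq_sqrt (h0' p hp)]
    ring
  refine (hc.add_of_sq_sub_sq hd (hq.congr fun p hp => ?_)).congr fun p _ => by ring
  have e1 := Real.sq_sqrt (h0 p hp)
  have e2 := Real.sq_sqrt (h0' p hp)
  generalize Real.sqrt (t p - (x p - a p) ^ 2) = w at *
  generalize Real.sqrt (t p - (x p - a' p) ^ 2) = w' at *
  rw [← e1, ← e2]
  linear_combination w ^ 2 * hσ + w' ^ 2 * hσ'

theorem Reach.and {X : Type} {K : Set (X → ℝ)} {A : Set X} {d e : ℕ}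
    {Φ Ψ : Set (X → ℝ) → Set X → Prop} (h : Reach Φ d K A)
    (hΦ : ∀ K A K' A', K ⊆ K' → A' ⊆ A → Φ K A → Φ K' A')
    (h' : ∀ K' A', K ⊆ K' → A' ⊆ A → Reach Ψ e K' A') :
    Reach (fun K' A' => Φ K' A' ∧ Ψ K' A') (d + e) K A :=
  h.bind fun K' A' hK hA h1 => (h' K' A' hK hA).imp fun _ _ hK' hA' h2 =>
    ⟨hΦ _ _ _ _ hK' hA' h1, h2⟩

theorem Reach.crit_sq_of_arith {X : Type} {K : Set (X → ℝ)} {A : Set X} {m γ : X → ℝ} {d e : ℕ}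
    (hm : Arith K d m) (hγ : Arith K e γ) :
    Reach (Crit 2 fun B z => SignConst B fun x => (z x - m x) ^ 2 - γ x) (d + (e + 5)) K A :=
  (hm.reach subset_rfl).bind fun _ _ hK _ h1 => (hγ.reach hK).bind fun _ _ hK' _ h2 =>
    crit_sq (hK' h1) h2

theorem Reach.arcPair {X : Type} {K : Set (X → ℝ)} {A : Set X} {a b a' b' t : X → ℝ} (ha : a ∈ K)
    (hb : b ∈ K) (ha' : a' ∈ K) (hb' : b' ∈ K) (ht : t ∈ K) :
    Reach (Crit 9 (ArcPair a b a' b' t)) 84 K A := by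
  have aa : Arith K 1 fun p => a p + a p := .add (.mem ha) (.mem ha)
  have aa' : Arith K 1 fun p => a' p + a' p := .add (.mem ha') (.mem ha')
  have am : Arith K 1 fun p => a p + a' p := .add (.mem ha) (.mem ha')
  have at4 : Arith K 3 fun p => t p + t p + (t p + t p) :=
    .add (.add (.mem ht) (.mem ht)) (.add (.mem ht) (.mem ht))
  have ac : Arith K 1 fun p => b p - b' p := .sub (.mem hb) (.mem hb')
  have ae : Arith K 1 fun p => a p - a' p := .sub (.mem ha) (.mem ha')
  have aN : Arith K 7 fun p => (a p - a' p) ^ 2 + (b p - b' p) ^ 2 := .add ae.sq ac.sq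
  -- Dividing by the squared distance of the centres brings the expression to the form handled by
  -- `crit_sq`.
  have hG : ∀ K' A', K ⊆ K' → Reach (Crit 2 fun B z => SignConst B fun p =>
      ((a p - a' p) ^ 2 + (b p - b' p) ^ 2) * (z p - (a p + a' p)) ^ 2 - (b p - b' p) ^ 2 *
        (t p + t p + (t p + t p) - ((a p - a' p) ^ 2 + (b p - b' p) ^ 2))) (9 + 29) K' A' := by
    intro K' A' hK
    refine (sign_of_arith (aN.mono hK)).bind fun K1 A1 hK1 hA1 hN => ?_
    have hnn (h0 : ∀ p ∈ A1, (a p - a' p) ^ 2 + (b p - b' p) ^ 2 ≠ 0) :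
        Reach (Crit 2 fun B z => SignConst B fun p =>
          ((a p - a' p) ^ 2 + (b p - b' p) ^ 2) * (z p - (a p + a' p)) ^ 2 - (b p - b' p) ^ 2 *
          (t p + t p + (t p + t p) - ((a p - a' p) ^ 2 + (b p - b' p) ^ 2))) 29 K1 A1 := by
      refine (div_of_arith ((ac.sq.mul (at4.sub aN)).mono (hK.trans hK1))
        (aN.mono (hK.trans hK1)) h0).bind (d' := 6) fun K2 A2 hK2 hA2 hd => ?_
      refine (crit_sq_of_arith (am.mono (hK.trans (hK1.trans hK2))) (.mem hd)).imp
        fun K3 A3 hK3 hA3 h => h.imp fun B hB z hz => ?_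
      have hB1 : B ⊆ A1 := hB.trans (hA3.trans hA2)
      refine ((hN.mono hB1).mul hz).congr fun p hp => ?_
      have := h0 p (hB1 hp)
      field_simp
    rcases hN.cases with h | h | h
    · exact hnn fun p hp => (h p hp).ne'
    -- The centres coincide, and the expression vanishes for every `z`.
    · refine .done ⟨∅, by simp, by simp, fun B hB z _ => .of_eq_zero fun p hp => ?_⟩
      have h1 := h p (hB hp)
      have h2 : (b p - b' p) ^ 2 = 0 :=
        le_antisymm (by linarith [sq_nonneg (a p - a' p)]) (sq_nonneg _)
      rw [h1, h2]
      ring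
    · exact hnn fun p hp => (h p hp).ne
  -- One summand for each hypothesis of `arcPair_of_signConst`. The signs `hc` and `he` do not
  -- involve `z` and are simply tested; the other five conditions contribute `2 + 2 + 1 + 2 + 2 = 9`
  -- critical values.
  refine Reach.mono_depth (d := 9 + (9 + (3 + (3 + (1 + (21 + 38)))))) ?_ (by norm_num)
  refine ((crit_sq_of_arith aa at4).and (fun _ _ _ _ hK hA h => h.mono hK hA) fun K1 A1 k1 _ =>
    (crit_sq_of_arith (aa'.mono k1) (at4.mono k1)).and (fun _ _ _ _ hK hA h => h.mono hK hA)
    fun K2 A2 k2 _ =>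
    (sign_of_arith (ac.mono (k1.trans k2))).and (fun _ _ _ _ hK hA h => h.mono hA)
    fun K3 A3 k3 _ =>
    (sign_of_arith (ae.mono (k1.trans (k2.trans k3)))).and (fun _ _ _ _ hK hA h => h.mono hA)
    fun K4 A4 k4 _ =>
    ((am.reach (k1.trans (k2.trans (k3.trans k4)))).imp fun _ _ _ _ h => Crit.linear h).and
    (fun _ _ _ _ hK hA h => h.mono hK hA) fun K5 A5 k5 _ =>
    (crit_sq_of_arith (am.mono (k1.trans (k2.trans (k3.trans (k4.trans k5)))))
      ((at4.sub ((ac.sq.add ac.sq).add ae.sq)).mono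
        (k1.trans (k2.trans (k3.trans (k4.trans k5)))))).and
    (fun _ _ _ _ hK hA h => h.mono hK hA) fun K6 A6 k6 _ =>
    hG K6 A6 (k1.trans (k2.trans (k3.trans (k4.trans (k5.trans k6)))))).imp ?_
  rintro K' A' - - ⟨h1, h2, hc, he, hm, h4, h5⟩
  exact (h1.and (h2.and (hm.and (h4.and h5)))).imp fun B hB z ⟨h1, h2, hm, h4, h5⟩ =>
    arcPair_of_signConst h1 h2 (hc.mono hB) (he.mono hB) hm h4 h5

/-! ### Incidences between points and circles -/

/-- Point location: a binary search for `2 x` among the sorted critical values finds the slab of the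
point, where the arcs have a fixed vertical order, and a binary search for `y` among the arcs
decides its position relative to every circle. -/
theorem Reach.locate {X J : Type} {K : Set (X → ℝ)} {A : Set X} {s : Finset J} {L k : ℕ}
    {a b : J → X → ℝ} {t x y : X → ℝ} {S : Finset (X → ℝ)}
    (ha : ∀ j ∈ s, a j ∈ K) (hb : ∀ j ∈ s, b j ∈ K) (ht : t ∈ K) (hx : x ∈ K) (hy : y ∈ K)
    (hs : s.card ≤ 2 ^ L) (hSk : S.card < 2 ^ k) (hSK : ∀ κ ∈ S, κ ∈ K)
    (hS : ∀ κ ∈ S, ∀ κ' ∈ S, SignConst A fun p => κ p - κ' p)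
    (harc : ∀ B ⊆ A, ∀ z : X → ℝ, (∀ κ ∈ S, SignConst B fun p => z p - κ p) →
      ∀ j ∈ s, ∀ j' ∈ s, ArcPair (a j) (b j) (a j') (b j') t B z) :
    Reach (fun _ B => ∀ j ∈ s, SignConst B fun p => (x p - a j p) ^ 2 + (y p - b j p) ^ 2 - t p)
      (1 + (k * 3 + (L + 2) * 9)) K A := by
  classical
  refine ((Arith.add (.mem hx) (.mem hx)).reach subset_rfl).bind fun K1 A1 k1 s1 h2x => ?_
  refine (search (f := fun κ : X → ℝ => κ) (h := fun p => x p + x p) hSk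
    (fun κ hκ κ' hκ' => (hS κ hκ κ' hκ').mono s1) fun κ hκ K' A' hK _ =>
      sign_of_arith (d := 1) (.sub (.mem (hK h2x)) (.mem (hK (k1 (hSK κ hκ)))))).bind
    fun K2 A2 k2 s2 hκ => ?_
  have hpair : ∀ j ∈ s, ∀ j' ∈ s, _ := fun j hj j' hj' =>
    harc A2 (s2.trans s1) _ hκ j hj j' hj' x rfl
  -- The circles met by the vertical line through the point. By the first half of `ArcPair`, these
  -- are the same for all inputs in `A2`, up to the degenerate case of an empty `A2`. The sign `±1`
  -- below selects the upper or the lower arc.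
  set D := s.filter fun j => ∀ p ∈ A2, 0 ≤ t p - (x p - a j p) ^ 2 with hD
  have hDs : ∀ j ∈ D, j ∈ s := fun j hj => (Finset.mem_filter.1 hj).1
  have hDn : ∀ j ∈ D, ∀ p ∈ A2, 0 ≤ t p - (x p - a j p) ^ 2 := fun j hj =>
    (Finset.mem_filter.1 hj).2
  have hσ : ∀ σ ∈ ({1, -1} : Finset ℝ), σ ^ 2 = 1 := by simp
  refine (search (s := D ×ˢ ({1, -1} : Finset ℝ)) (h := y) (k := L + 2) (c := 9)
    (f := fun i p => b i.1 p + i.2 * Real.sqrt (t p - (x p - a i.1 p) ^ 2)) ?_ ?_ ?_).imp ?_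
  · rw [Finset.card_product, pow_add]
    have h1 : D.card ≤ s.card := Finset.card_filter_le _ _
    have h2 : ({1, -1} : Finset ℝ).card ≤ 2 := Finset.card_le_two
    have h3 : 0 < 2 ^ L := by positivity
    nlinarith
  · intro i hi i' hi'
    rw [Finset.mem_product] at hi hi'
    exact (hpair i.1 (hDs _ hi.1) i'.1 (hDs _ hi'.1)).2 (hDn _ hi.1) (hDn _ hi'.1) _ _
      (hσ _ hi.2) (hσ _ hi'.2)
  · intro i hi K' A' hK hA
    rw [Finset.mem_product] at hi
    have kk : K ⊆ K' := k1.trans (k2.trans hK)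
    have ax : Arith K' 1 fun p => x p - a i.1 p :=
      .sub (.mem (kk hx)) (.mem (kk (ha _ (hDs _ hi.1))))
    refine (sqrt_of_arith (.sub (.mem (kk ht)) ax.sq) fun p hp => hDn _ hi.1 p (hA hp)).bind
      (d' := 4) fun K3 A3 k3 _ hw => ?_
    have hb3 : Arith K3 0 (b i.1) := .mem (k3 (kk (hb _ (hDs _ hi.1))))
    have hy3 : Arith K3 0 y := .mem (k3 (kk hy))
    have hσi := hi.2
    rw [Finset.mem_insert, Finset.mem_singleton] at hσi
    rcases hσi with h | h
    · refine (sign_of_arith (hy3.sub (hb3.add (.mem hw)))).imp fun _ _ _ _ h' =>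
        h'.congr fun p _ => ?_
      rw [h, one_mul]
    · refine (sign_of_arith (hy3.sub (hb3.sub (.mem hw)))).imp fun _ _ _ _ h' =>
        h'.congr fun p _ => ?_
      rw [h]
      ring
  · intro K3 A3 _ s3 h j hj
    -- The expression factors as the product of the vertical offsets of the point from the upper and
    -- the lower arc.
    have hdom (h0 : ∀ p ∈ A2, 0 ≤ t p - (x p - a j p) ^ 2) :
        SignConst A3 fun p => (x p - a j p) ^ 2 + (y p - b j p) ^ 2 - t p := by
      have hjD : j ∈ D := Finset.mem_filter.2 ⟨hj, h0⟩
      refine ((h (j, 1) (Finset.mem_product.2 ⟨hjD, by simp⟩)).mul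
        (h (j, -1) (Finset.mem_product.2 ⟨hjD, by simp⟩))).congr fun p hp => ?_
      have := Real.sq_sqrt (h0 p (s3 hp))
      dsimp only
      linear_combination -this
    rcases (hpair j hj j hj).1.cases with h1 | h1 | h1
    · exact hdom fun p hp => (h1 p hp).le
    · exact hdom fun p hp => (h1 p hp).ge
    · exact .of_pos fun p hp => by nlinarith [h1 p (s3 hp), sq_nonneg (y p - b j p)]

/-- The incidences between `s` points and `r` circles of the same radius. -/
theorem Reach.incidences {X I J : Type} {K : Set (X → ℝ)} {A : Set X} {r : Finset I} {s : Finset J}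
    {L : ℕ} {a b : J → X → ℝ} {x y : I → X → ℝ} {t : X → ℝ}
    (ha : ∀ j ∈ s, a j ∈ K) (hb : ∀ j ∈ s, b j ∈ K) (ht : t ∈ K) (hx : ∀ i ∈ r, x i ∈ K)
    (hy : ∀ i ∈ r, y i ∈ K) (hs : s.card ≤ 2 ^ L) :
    Reach (fun _ B => ∀ i ∈ r, ∀ j ∈ s,
        SignConst B fun p => (x i p - a j p) ^ 2 + (y i p - b j p) ^ 2 - t p)
      (s.card ^ 2 * (54 * L + 192) + r.card * (15 * L + 31)) K A := by
  have hc : s.card ^ 2 * 84 + (s.card ^ 2 * 9 * ((2 * L + 4) * 3) +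
      r.card * (1 + ((2 * L + 4) * 3 + (L + 2) * 9))) =
      s.card ^ 2 * (54 * L + 192) + r.card * (15 * L + 31) := by ring
  rw [← hc, pow_two, ← Finset.card_product]
  refine (forall_finset (s ×ˢ s) 84
    (Φ := fun i => Crit 9 (ArcPair (a i.1) (b i.1) (a i.2) (b i.2) t))
    (fun _ _ _ _ _ hK hA h => h.mono hK hA) fun i hi K' A' hK _ => ?_).bind
    fun K1 A1 k1 s1 h1 => ?_
  · rw [Finset.mem_product] at hi
    exact arcPair (hK (ha _ hi.1)) (hK (hb _ hi.1)) (hK (ha _ hi.2)) (hK (hb _ hi.2)) (hK ht)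
  obtain ⟨S, hS, hSK, hP⟩ := Crit.forall_finset _ h1
  -- Nine values for each of the at most `2 ^ (2 * L)` pairs, and `9 < 2 ^ 4`.
  have hSk : S.card < 2 ^ (2 * L + 4) := by
    refine hS.trans_lt ?_
    rw [Finset.card_product, pow_add, mul_comm 2 L, pow_mul]
    have : 0 < 2 ^ L := by positivity
    nlinarith
  refine ((sort (K := K1) (A := A1) (f := fun κ : X → ℝ => κ) hSk hSK).mono_depth
    (Nat.mul_le_mul_right _ hS)).bind fun K2 A2 k2 s2 h2 => ?_
  refine forall_finset r _ (Φ := fun i _ B => ∀ j ∈ s,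
    SignConst B fun p => (x i p - a j p) ^ 2 + (y i p - b j p) ^ 2 - t p)
    (fun i _ _ _ _ _ hA h j hj => (h j hj).mono hA) fun i hi K3 A3 k3 s3 => ?_
  have kk : K ⊆ K3 := k1.trans (k2.trans k3)
  exact locate (fun j hj => kk (ha j hj)) (fun j hj => kk (hb j hj)) (kk ht) (kk (hx i hi))
    (kk (hy i hi)) hs hSk (fun κ hκ => k3 (k2 (hSK κ hκ)))
    (fun κ hκ κ' hκ' => (h2 κ hκ κ' hκ').mono s3)
    fun B hB z hz j hj j' hj' => hP B (hB.trans (s3.trans s2)) z hz (j, j')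
      (Finset.mem_product.2 ⟨hj, hj'⟩)

/-- The incidences between `n` points and `n` circles of the same radius, with the circles divided
into `s` groups of `s`, where `n ≤ s ^ 2`. -/
theorem Reach.incidences_fin {X : Type} {K : Set (X → ℝ)} {A : Set X} {n s L : ℕ}
    {a b x y : Fin n → X → ℝ} {t : X → ℝ} (ha : ∀ j, a j ∈ K) (hb : ∀ j, b j ∈ K) (ht : t ∈ K)
    (hx : ∀ i, x i ∈ K) (hy : ∀ i, y i ∈ K) (hn : n ≤ s ^ 2) (hs : s ≤ 2 ^ L) :
    Reach (fun _ B => ∀ i j,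
        SignConst B fun p => (x i p - a j p) ^ 2 + (y i p - b j p) ^ 2 - t p)
      (s ^ 3 * (69 * L + 223)) K A := by
  classical
  rcases Nat.eq_zero_or_pos s with rfl | hs0
  · obtain rfl : n = 0 := by simpa using hn
    exact .done fun i => i.elim0
  -- Indices with the same quotient by `s` have different remainders.
  have hcard (g : ℕ) : (Finset.univ.filter fun j : Fin n => j.val / s = g).card ≤ s := by
    have : ((Finset.univ.filter fun j : Fin n => j.val / s = g).image fun j => j.val % s) ⊆
        Finset.range s := by
      intro m hm
      obtain ⟨j, _, rfl⟩ := Finset.mem_image.1 hm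
      exact Finset.mem_range.2 (Nat.mod_lt _ hs0)
    have h := Finset.card_le_card this
    rwa [Finset.card_range, Finset.card_image_of_injOn] at h
    intro j hj j' hj' h
    simp only [Finset.coe_filter, Finset.mem_univ, true_and, Set.mem_ofPred_eq] at hj hj'
    refine Fin.ext ?_
    rw [← Nat.div_add_mod j.val s, ← Nat.div_add_mod j'.val s, hj, hj']
    exact congrArg _ h
  refine ((forall_finset (Finset.range s) (s ^ 2 * (54 * L + 192) + s ^ 2 * (15 * L + 31))
    (Φ := fun g _ B => ∀ i ∈ (Finset.univ : Finset (Fin n)),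
      ∀ j ∈ Finset.univ.filter fun j : Fin n => j.val / s = g,
      SignConst B fun p => (x i p - a j p) ^ 2 + (y i p - b j p) ^ 2 - t p)
    (fun g _ _ _ _ _ hA h i hi j hj => (h i hi j hj).mono hA)
    fun g _ K' A' hK _ => (incidences (L := L) (fun j _ => hK (ha j)) (fun j _ => hK (hb j)) (hK ht)
      (fun i _ => hK (hx i)) (fun i _ => hK (hy i)) ((hcard g).trans hs)).mono_depth ?_).imp
    fun K' A' _ _ h i j => ?_).mono_depth (le_of_eq ?_)
  · rw [Finset.card_univ, Fintype.card_fin]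
    have := Nat.pow_le_pow_left (hcard g) 2
    gcongr
  · refine h (j.val / s) (Finset.mem_range.2 ?_) i (Finset.mem_univ i) j (by simp)
    rw [Nat.div_lt_iff_lt_mul hs0, ← pow_two]
    exact j.isLt.trans_le hn
  · rw [Finset.card_range]
    ring

/-! ### Hitting sets -/

/-- A family of fewer than `2 ^ m` subsets of `E`, each with at least half of the elements of `E`,
is hit by `m` elements. -/
theorem Finset.exists_hitting_set {ε : Type*} [DecidableEq ε] (E : Finset ε) :
    ∀ (m : ℕ) (F : Finset (Finset ε)), F.card < 2 ^ m →
      (∀ S ∈ F, S ⊆ E ∧ S.Nonempty ∧ E.card ≤ 2 * S.card) →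
      ∃ R ⊆ E, R.card ≤ m ∧ ∀ S ∈ F, ∃ r ∈ R, r ∈ S := by
  intro m
  induction m with
  | zero =>
    intro F hF _
    obtain rfl : F = ∅ := by simpa using hF
    exact ⟨∅, by simp, by simp, by simp⟩
  | succ m ih =>
    intro F hF hE
    rcases F.eq_empty_or_nonempty with rfl | ⟨S0, hS0⟩
    · exact ⟨∅, by simp, by simp, by simp⟩
    have hEne : E.Nonempty := (hE S0 hS0).2.1.mono (hE S0 hS0).1
    -- Double counting of the pairs `e ∈ S`: some element lies in at least half of the sets.
    -- Choosing it leaves fewer than `2 ^ m` sets to hit.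
    obtain ⟨e, he, hhalf⟩ : ∃ e ∈ E, F.card ≤ 2 * (F.filter fun S => e ∈ S).card := by
      by_contra! hlt
      have h1 : ∑ e ∈ E, 2 * (F.filter fun S => e ∈ S).card < ∑ _e ∈ E, F.card :=
        Finset.sum_lt_sum_of_nonempty hEne hlt
      have h2 : ∑ e ∈ E, (F.filter fun S => e ∈ S).card = ∑ S ∈ F, S.card := by
        simp only [Finset.card_filter]
        rw [Finset.sum_comm]
        refine Finset.sum_congr rfl fun S hS => ?_
        rw [← Finset.card_filter, Finset.filter_mem_eq_inter,
          Finset.inter_eq_right.2 (hE S hS).1]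
      have h3 : ∑ _S ∈ F, E.card ≤ ∑ S ∈ F, 2 * S.card :=
        Finset.sum_le_sum fun S hS => (hE S hS).2.2
      rw [← Finset.mul_sum, h2, Finset.sum_const, smul_eq_mul] at h1
      rw [← Finset.mul_sum, Finset.sum_const, smul_eq_mul] at h3
      linarith [mul_comm E.card F.card]
    have hsplit := Finset.card_filter_add_card_filter_not (s := F) fun S => e ∈ S
    obtain ⟨R, hRE, hR, hhit⟩ := ih (F.filter fun S => e ∉ S) (by rw [pow_succ] at hF; omega)
      fun S hS => hE S (Finset.mem_filter.1 hS).1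
    refine ⟨insert e R, Finset.insert_subset he hRE,
      (Finset.card_insert_le _ _).trans (by omega), fun S hS => ?_⟩
    by_cases heS : e ∈ S
    · exact ⟨e, Finset.mem_insert_self _ _, heS⟩
    · obtain ⟨r, hr, hrS⟩ := hhit S (Finset.mem_filter.2 ⟨hS, heS⟩)
      exact ⟨r, Finset.mem_insert_of_mem hr, hrS⟩

/-! ### Searching for an unknown among many values -/

section Optimize

variable {X ε : Type}

/-- The values `v e`, `e : ε`, can be computed at cost `c` from `K₀`, and, for any available
number, its order relative to all of these values can be found at cost `D`. -/
structure Comparable (v : ε → X → ℝ) (K₀ : Set (X → ℝ)) (c D : ℕ) : Prop where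
  compute : ∀ e K A, K₀ ⊆ K → Reach (fun K' _ => v e ∈ K') c K A
  compare : ∀ t K A, K₀ ⊆ K → t ∈ K → Reach (fun _ B => ∀ e, SignConst B fun x => v e x - t x) D K A

/-- `v e x` lies strictly between the values with indices `o.1` and `o.2`, where `none` stands for
an infinite value. -/
def Between (v : ε → X → ℝ) (o : Option ε × Option ε) (x : X) (e : ε) : Prop :=
  (∀ l ∈ o.1, v l x < v e x) ∧ ∀ u ∈ o.2, v e x < v u x

variable {v : ε → X → ℝ} {K₀ K : Set (X → ℝ)} {A : Set X} {c D : ℕ}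

theorem Comparable.reach_option (hv : Comparable v K₀ c D) (hK : K₀ ⊆ K) (o : Option ε) :
    Reach (fun _ B => ∀ l ∈ o, ∀ e, SignConst B fun x => v e x - v l x) (c + D) K A := by
  cases o with
  | none => exact .done (by simp)
  | some l =>
    refine (hv.compute l K A hK).bind fun K' A' hK' _ h =>
      (hv.compare _ K' A' (hK.trans hK') h).imp fun _ _ _ _ h' l' hl' => ?_
    obtain rfl : l = l' := by simpa using hl'
    exact h'

/-- Comparing all values with each of the two bounds suffices. This tree is never used for its speed
alone: its depth also bounds, through `Reach.encard_image_le`, the number of different sets that two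
bounds can cut out. -/
theorem Comparable.reach_between (hv : Comparable v K₀ c D) (hK : K₀ ⊆ K)
    (o : Option ε × Option ε) :
    Reach (fun _ B => ∀ x ∈ B, ∀ y ∈ B, ∀ e, Between v o x e ↔ Between v o y e)
      (2 * (c + D)) K A := by
  rw [two_mul]
  refine (hv.reach_option hK o.1).bind fun K' A' hK' _ h1 =>
    (hv.reach_option (hK.trans hK') o.2).imp fun K'' B _ hB h2 x hx y hy e => ?_
  exact and_congr (forall₂_congr fun l hl => (h1 l hl e).gt_iff (hB hx) (hB hy))
    (forall₂_congr fun u hu => (h2 u hu e).lt_iff hx hy)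

open Classical in
/-- A small set of indices meets all the large sets of indices in `E` that are cut out by two
values. -/
theorem Comparable.exists_net [Fintype ε] (hv : Comparable v K₀ c D) (hK : K₀ ⊆ K) (E : Finset ε) {a k : ℕ}
    (ha : Fintype.card (Option ε × Option ε) < 2 ^ a) (hE : E.card < 2 ^ (k + 1)) :
    ∃ R ⊆ E, R.card ≤ a + 2 * (c + D) ∧ ∀ x ∈ A, ∀ o : Option ε × Option ε,
      (∀ r ∈ R, ¬ Between v o x r) → (E.filter (Between v o x)).card < 2 ^ k := by
  set F : Finset (Finset ε) := Finset.univ.filter fun S => 2 ^ k ≤ S.card ∧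
    ∃ o, ∃ x ∈ A, S = E.filter (Between v o x) with hF
  -- Fewer than `2 ^ a` pairs of bounds, each with at most `2 ^ (2 * (c + D))` sets as the input
  -- ranges over `A`.
  have hcount : F.card < 2 ^ (a + 2 * (c + D)) := by
    have hfin (o : Option ε × Option ε) :
        ((fun x => E.filter (Between v o x)) '' A).encard ≤ 2 ^ (2 * (c + D)) :=
      Reach.encard_image_le _ (hv.reach_between hK o) fun K' A' h x hx y hy => by
        refine Finset.filter_congr fun e _ => h x hx y hy e
    have hsub : F ⊆ Finset.univ.biUnion fun o : Option ε × Option ε =>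
        ((fun x => E.filter (Between v o x)) '' A).toFinset := by
      intro S hS
      obtain ⟨-, o, x, hx, rfl⟩ := (Finset.mem_filter.1 hS).2
      exact Finset.mem_biUnion.2 ⟨o, Finset.mem_univ _, Set.mem_toFinset.2 ⟨x, hx, rfl⟩⟩
    refine (Finset.card_le_card hsub).trans_lt ?_
    refine (Finset.card_biUnion_le_card_mul _ _ (2 ^ (2 * (c + D))) fun o _ => ?_).trans_lt ?_
    · have := hfin o
      rw [← Set.coe_toFinset ((fun x => E.filter (Between v o x)) '' A),
        Set.encard_coe_eq_coe_finsetCard] at this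
      exact_mod_cast this
    · rw [pow_add, Finset.card_univ]
      gcongr
  obtain ⟨R, hRE, hR, hhit⟩ := E.exists_hitting_set _ F hcount fun S hS => by
    obtain ⟨hk, o, x, -, rfl⟩ := (Finset.mem_filter.1 hS).2
    refine ⟨Finset.filter_subset _ _, Finset.card_pos.1 (lt_of_lt_of_le (by positivity) hk), ?_⟩
    rw [pow_succ] at hE
    omega
  refine ⟨R, hRE, hR, fun x hx o hno => ?_⟩
  by_contra! hc
  obtain ⟨r, hrR, hr⟩ := hhit _ (Finset.mem_filter.2 ⟨Finset.mem_univ _, hc, o, x, hx, rfl⟩)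
  exact hno r hrR (Finset.mem_filter.1 hr).2

theorem exists_neighbors (v : ε → ℝ) (R : Finset ε) (T : ℝ) :
    ∃ o : Option ε × Option ε,
      ((∀ l ∈ o.1, l ∈ R ∧ v l < T) ∧ ∀ u ∈ o.2, u ∈ R ∧ T < v u) ∧
      ∀ r ∈ R, (v r < T → ∃ l ∈ o.1, v r ≤ v l) ∧ (T < v r → ∃ u ∈ o.2, v u ≤ v r) := by
  have h1 : ∃ o : Option ε, (∀ l ∈ o, l ∈ R ∧ v l < T) ∧
      ∀ r ∈ R, v r < T → ∃ l ∈ o, v r ≤ v l := by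
    rcases (R.filter fun r => v r < T).eq_empty_or_nonempty with h | h
    · exact ⟨none, by simp, fun r hr hlt =>
        absurd (Finset.mem_filter.2 ⟨hr, hlt⟩) (h ▸ Finset.notMem_empty r)⟩
    · obtain ⟨l, hl, hmax⟩ := Finset.exists_max_image _ v h
      exact ⟨some l, by simpa using hl, fun r hr hlt =>
        ⟨l, rfl, hmax r (Finset.mem_filter.2 ⟨hr, hlt⟩)⟩⟩
  have h2 : ∃ o : Option ε, (∀ u ∈ o, u ∈ R ∧ T < v u) ∧
      ∀ r ∈ R, T < v r → ∃ u ∈ o, v u ≤ v r := by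
    rcases (R.filter fun r => T < v r).eq_empty_or_nonempty with h | h
    · exact ⟨none, by simp, fun r hr hlt =>
        absurd (Finset.mem_filter.2 ⟨hr, hlt⟩) (h ▸ Finset.notMem_empty r)⟩
    · obtain ⟨u, hu, hmin⟩ := Finset.exists_min_image _ v h
      exact ⟨some u, by simpa using hu, fun r hr hlt =>
        ⟨u, rfl, hmin r (Finset.mem_filter.2 ⟨hr, hlt⟩)⟩⟩
  obtain ⟨o1, h1, h1'⟩ := h1
  obtain ⟨o2, h2, h2'⟩ := h2
  exact ⟨(o1, o2), ⟨h1, h2⟩, fun r hr => ⟨h1' r hr, h2' r hr⟩⟩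

/-- The unknown `T` is `b` or one of the values with indices in `E`. -/
def Candidates (v : ε → X → ℝ) (T : X → ℝ) (E : Finset ε) (b : X → ℝ) (A : Set X) : Prop :=
  ∀ x ∈ A, T x = b x ∨ ∃ e ∈ E, T x = v e x

/-- `T` is an unknown whose order relative to `v r` is determined by the order of `v r` relative to
all values. -/
def DeterminedByOrder (v : ε → X → ℝ) (T : X → ℝ) : Prop :=
  ∀ (B : Set X) (r : ε), (∀ e, SignConst B fun x => v e x - v r x) →
    SignConst B fun x => T x - v r x

/-- The summands of the depth: computing the values of the net `R`, sorting them, a binary search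
for `T` with one full comparison per step, and finding the indices between the neighbours of `T`. No
value of `R` lies strictly between these neighbours, so fewer than `2 ^ k` candidates do. -/
theorem Comparable.halve [Fintype ε] (hv : Comparable v K₀ c D) (hK : K₀ ⊆ K) {T : X → ℝ}
    (hT : DeterminedByOrder v T) {E : Finset ε} {b : X → ℝ} (hb : b ∈ K) (hE : Candidates v T E b A)
    {a k q : ℕ} (ha : Fintype.card (Option ε × Option ε) < 2 ^ a) (hk : E.card < 2 ^ (k + 1))
    (hq : a + 2 * (c + D) < 2 ^ q) :
    Reach (fun K' B => ∃ E' : Finset ε, E'.card < 2 ^ k ∧ ∃ b' ∈ K', Candidates v T E' b' B)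
      ((a + 2 * (c + D)) * c + ((a + 2 * (c + D)) * (q * 3) + (q * D + 2 * (c + D)))) K A := by
  classical
  obtain ⟨R, hRE, hRc, hnet⟩ := hv.exists_net (A := A) hK E ha hk
  refine ((Reach.forall_finset R c (Φ := fun r K' _ => v r ∈ K') (fun _ _ _ _ _ hK _ h => hK h)
    fun r _ K' A' hK' _ => hv.compute r K' A' (hK.trans hK')).mono_depth
    (Nat.mul_le_mul_right _ hRc)).bind fun K1 A1 k1 s1 hR1 => ?_
  refine ((Reach.sort (hRc.trans_lt hq) hR1).mono_depth (Nat.mul_le_mul_right _ hRc)).bind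
    fun K2 A2 k2 s2 hord => ?_
  refine (Reach.search (h := T) (hRc.trans_lt hq) hord fun r hr K' A' hK' _ =>
    (hv.compare (v r) K' A' (hK.trans (k1.trans (k2.trans hK'))) (hK' (k2 (hR1 r hr)))).imp
      fun _ B _ _ h => hT B r h).bind fun K3 A3 k3 s3 hTR => ?_
  rcases A3.eq_empty_or_nonempty with rfl | ⟨x0, hx0⟩
  · exact .done ⟨∅, by simp, b, k3 (k2 (k1 hb)), fun x hx => absurd hx (Set.notMem_empty x)⟩
  by_cases hex : ∃ r ∈ R, T x0 = v r x0
  · obtain ⟨r, hr, hrx⟩ := hex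
    exact .done ⟨∅, by simp, v r, k3 (k2 (hR1 r hr)), fun x hx =>
      .inl (((hTR r hr).eq_iff hx0 hx).1 hrx)⟩
  push Not at hex
  -- The neighbours are chosen at one input, but the order of `R` and `T` is constant on `A3`, so
  -- they are neighbours at all inputs there.
  obtain ⟨o, ho, hRo⟩ := exists_neighbors (fun e => v e x0) R (T x0)
  refine (hv.reach_between (hK.trans (k1.trans (k2.trans k3))) o).imp fun K4 A4 k4 s4 hbet => ?_
  have hb4 : b ∈ K4 := k4 (k3 (k2 (k1 hb)))
  rcases A4.eq_empty_or_nonempty with rfl | ⟨x1, hx1⟩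
  · exact ⟨∅, by simp, b, hb4, fun x hx => absurd hx (Set.notMem_empty x)⟩
  refine ⟨E.filter (Between v o x1), hnet x1 (s1 (s2 (s3 (s4 hx1)))) o fun r hr hrb => ?_,
    b, hb4, fun x hx => (hE x (s1 (s2 (s3 (s4 hx))))).imp_right fun ⟨e, he, hTe⟩ =>
      ⟨e, Finset.mem_filter.2 ⟨he, (hbet x hx x1 hx1 e).1 ⟨fun l hl => ?_, fun u hu => ?_⟩⟩, hTe⟩⟩
  · rcases lt_or_gt_of_ne (hex r hr) with h | h
    · obtain ⟨u, hu, hur⟩ := (hRo r hr).2 h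
      have := ((hord u (ho.2 u hu).1 r hr).le_iff (s3 hx0) (s3 (s4 hx1))).1 hur
      exact absurd (hrb.2 u hu) (not_lt.2 this)
    · obtain ⟨l, hl, hlr⟩ := (hRo r hr).1 h
      have := ((hord r hr l (ho.1 l hl).1).le_iff (s3 hx0) (s3 (s4 hx1))).1 hlr
      exact absurd (hrb.1 l hl) (not_lt.2 this)
  · rw [← hTe]
    exact ((hTR l (ho.1 l hl).1).gt_iff hx0 (s4 hx)).1 (ho.1 l hl).2
  · rw [← hTe]
    exact ((hTR u (ho.2 u hu).1).lt_iff hx0 (s4 hx)).1 (ho.2 u hu).2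

theorem Comparable.find [Fintype ε] (hv : Comparable v K₀ c D) {T : X → ℝ}
    (hT : DeterminedByOrder v T) {a q : ℕ} (ha : Fintype.card (Option ε × Option ε) < 2 ^ a)
    (hq : a + 2 * (c + D) < 2 ^ q) :
    ∀ (k : ℕ) {K : Set (X → ℝ)} {A : Set X} {E : Finset ε} {b : X → ℝ}, K₀ ⊆ K → b ∈ K →
      Candidates v T E b A → E.card < 2 ^ k →
      Reach (fun K' B => ∃ b' ∈ K', ∀ x ∈ B, T x = b' x)
        (k * ((a + 2 * (c + D)) * c + ((a + 2 * (c + D)) * (q * 3) + (q * D + 2 * (c + D))))) K A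
    := by
  intro k
  induction k with
  | zero =>
    intro K A E b _ hb hE hk
    obtain rfl : E = ∅ := by simpa using hk
    exact .done ⟨b, hb, fun x hx => by simpa using hE x hx⟩
  | succ k ih =>
    intro K A E b hK hb hE hk
    rw [Nat.add_mul, one_mul, Nat.add_comm]
    refine (hv.halve hK hT hb hE ha hk hq).bind fun K' B hK' _ ⟨E', hE', b', hb', hcand⟩ =>
      ih (hK.trans hK') hb' hcand hE'

end Optimize

/-! ### The discrete Fréchet distance -/

section Frechet

variable {n : ℕ}

/-- The pairs of sequences of `n` points. -/
abbrev SeqPair (n : ℕ) : Type := (Fin n → Plane) × (Fin n → Plane)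

/-- The squared distance of `p_i` and `q_j`, where `e = (i, j)`. -/
def sqDist (e : Fin n × Fin n) (x : SeqPair n) : ℝ :=
  (x.1 e.1 0 - x.2 e.2 0) ^ 2 + (x.1 e.1 1 - x.2 e.2 1) ^ 2

theorem sqDist_nonneg (e : Fin n × Fin n) (x : SeqPair n) : 0 ≤ sqDist e x := by
  unfold sqDist
  positivity

theorem dist_eq_sqrt_sqDist (e : Fin n × Fin n) (x : SeqPair n) :
    dist (x.1 e.1) (x.2 e.2) = Real.sqrt (sqDist e x) := by
  rw [EuclideanSpace.dist_eq, Fin.sum_univ_two, Real.dist_eq, Real.dist_eq, sq_abs, sq_abs]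
  rfl

/-- The functions given by the inputs of a tree. -/
def inputFunctions (n : ℕ) : Set (SeqPair n → ℝ) :=
  Set.range fun (w : FrechetVar n) (x : SeqPair n) => frechetInput x.1 x.2 w

theorem comparable_sqDist {s L : ℕ} (hn : n ≤ s ^ 2) (hs : s ≤ 2 ^ L) :
    Comparable (sqDist (n := n)) (inputFunctions n) 7 (s ^ 3 * (69 * L + 223)) := by
  have hp (i : Fin n) (l : Fin 2) : (fun x : SeqPair n => x.1 i l) ∈ inputFunctions n :=
    ⟨.inl (i, l), rfl⟩
  have hq (i : Fin n) (l : Fin 2) : (fun x : SeqPair n => x.2 i l) ∈ inputFunctions n :=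
    ⟨.inr (i, l), rfl⟩
  refine ⟨fun e K A hK => ?_, fun t K A hK ht => ?_⟩
  · exact (Arith.add (Arith.sub (.mem (hK (hp e.1 0))) (.mem (hK (hq e.2 0)))).sq
      (Arith.sub (.mem (hK (hp e.1 1))) (.mem (hK (hq e.2 1)))).sq).reach subset_rfl
  · exact (Reach.incidences_fin (a := fun j x => x.2 j 0) (b := fun j x => x.2 j 1)
      (x := fun i x => x.1 i 0) (y := fun i x => x.1 i 1) (fun j => hK (hq j 0))
      (fun j => hK (hq j 1)) ht (fun j => hK (hp j 0)) (fun j => hK (hp j 1)) hn hs).imp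
      fun _ _ _ _ h e => h e.1 e.2

variable [NeZero n]

/-- There is a path from the first pair to the last pair through the pairs in `M`. -/
def PairReachable (M : Fin n × Fin n → Prop) : Prop :=
  M (0, 0) ∧ Relation.ReflTransGen (fun a b : Fin n × Fin n =>
    ((b.1.val = a.1.val ∧ b.2.val = a.2.val + 1) ∨
      (b.1.val = a.1.val + 1 ∧ b.2.val = a.2.val) ∨
      (b.1.val = a.1.val + 1 ∧ b.2.val = a.2.val + 1)) ∧ M a ∧ M b) (0, 0) (Fin.rev 0, Fin.rev 0)

theorem PairReachable.mono {M M' : Fin n × Fin n → Prop} (h : PairReachable M)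
    (hM : ∀ e, M e → M' e) : PairReachable M' :=
  ⟨hM _ h.1, Relation.ReflTransGen.mono (fun _ _ hab => ⟨hab.1, hM _ hab.2.1, hM _ hab.2.2⟩) _ _ h.2⟩

theorem PairReachable.of_forall {M : Fin n × Fin n → Prop} (hM : ∀ e, M e) : PairReachable M := by
  refine ⟨hM _, ?_⟩
  have key (i : ℕ) (hi : i < n) : Relation.ReflTransGen (fun a b : Fin n × Fin n =>
      ((b.1.val = a.1.val ∧ b.2.val = a.2.val + 1) ∨
      (b.1.val = a.1.val + 1 ∧ b.2.val = a.2.val) ∨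
      (b.1.val = a.1.val + 1 ∧ b.2.val = a.2.val + 1)) ∧ M a ∧ M b) (0, 0) (⟨i, hi⟩, ⟨i, hi⟩) := by
    induction i with
    | zero => exact .refl
    | succ i ih =>
      exact (ih (by omega)).tail ⟨.inr (.inr ⟨rfl, rfl⟩), hM _, hM _⟩
  exact key _ (Fin.rev 0).isLt

theorem frechetReachable_iff (x : SeqPair n) (δ : ℝ) :
    FrechetReachable x.1 x.2 δ ↔ PairReachable fun e => dist (x.1 e.1) (x.2 e.2) ≤ δ :=
  Iff.rfl

/-- The least value below which the end can be reached. -/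
theorem exists_bottleneck (v : Fin n × Fin n → ℝ) : ∃ T : ℝ, (∃ e, T = v e) ∧
    (∀ t, T ≤ t ↔ PairReachable fun e => v e ≤ t) ∧
    ∀ t, T < t ↔ PairReachable fun e => v e < t := by
  classical
  have hne : (Finset.univ.filter fun e => PairReachable fun e' => v e' ≤ v e).Nonempty := by
    obtain ⟨e, -, he⟩ := Finset.exists_max_image Finset.univ v
      (Finset.univ_nonempty (α := Fin n × Fin n))
    exact ⟨e, Finset.mem_filter.2 ⟨Finset.mem_univ _,
      .of_forall fun e' => he e' (Finset.mem_univ _)⟩⟩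
  obtain ⟨e, he, hmin⟩ := Finset.exists_min_image _ v hne
  have hre := (Finset.mem_filter.1 he).2
  -- The largest value satisfying `p` is itself a sufficient threshold, hence at least the minimal
  -- one. This treats `≤ t` and `< t` alike.
  have below (p : ℝ → Prop) (hp : PairReachable fun e' => p (v e')) : ∃ e', p (v e') ∧ v e ≤ v e' := by
    obtain ⟨e', he', hmax⟩ := Finset.exists_max_image (Finset.univ.filter fun e' => p (v e')) v
      ⟨(0, 0), Finset.mem_filter.2 ⟨Finset.mem_univ _, hp.1⟩⟩
    exact ⟨e', (Finset.mem_filter.1 he').2, hmin e' (Finset.mem_filter.2 ⟨Finset.mem_univ _,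
      hp.mono fun e'' h => hmax e'' (Finset.mem_filter.2 ⟨Finset.mem_univ _, h⟩)⟩)⟩
  refine ⟨v e, ⟨e, rfl⟩, fun t => ⟨fun ht => hre.mono fun e' h => h.trans ht, fun h => ?_⟩,
    fun t => ⟨fun ht => hre.mono fun e' h => h.trans_lt ht, fun h => ?_⟩⟩
  · obtain ⟨e', h1, h2⟩ := below (· ≤ t) h
    exact h2.trans h1
  · obtain ⟨e', h1, h2⟩ := below (· < t) h
    exact h2.trans_lt h1

/-- The squared discrete Fréchet distance. -/
noncomputable def sqFrechet (x : SeqPair n) : ℝ := (exists_bottleneck fun e => sqDist e x).choose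

theorem sqFrechet_eq (x : SeqPair n) : ∃ e, sqFrechet x = sqDist e x :=
  (exists_bottleneck fun e => sqDist e x).choose_spec.1

theorem sqFrechet_le_iff (x : SeqPair n) (t : ℝ) :
    sqFrechet x ≤ t ↔ PairReachable fun e => sqDist e x ≤ t :=
  (exists_bottleneck fun e => sqDist e x).choose_spec.2.1 t

theorem sqFrechet_lt_iff (x : SeqPair n) (t : ℝ) :
    sqFrechet x < t ↔ PairReachable fun e => sqDist e x < t :=
  (exists_bottleneck fun e => sqDist e x).choose_spec.2.2 t

theorem sqFrechet_nonneg (x : SeqPair n) : 0 ≤ sqFrechet x := by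
  obtain ⟨e, he⟩ := sqFrechet_eq x
  exact he ▸ sqDist_nonneg e x

theorem isDiscreteFrechetDist_sqrt (x : SeqPair n) :
    IsDiscreteFrechetDist x.1 x.2 (Real.sqrt (sqFrechet x)) := by
  refine ⟨(frechetReachable_iff x _).2 (((sqFrechet_le_iff x _).1 le_rfl).mono fun e he => ?_),
    fun δ hδ => ?_⟩
  · rw [dist_eq_sqrt_sqDist]
    exact Real.sqrt_le_sqrt he
  · have hδ' := (frechetReachable_iff x δ).1 hδ
    have h0 : 0 ≤ δ := dist_nonneg.trans hδ'.1
    refine (Real.sqrt_le_left h0).2 ((sqFrechet_le_iff x _).2 (hδ'.mono fun e he => ?_))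
    rw [dist_eq_sqrt_sqDist] at he
    exact (Real.sqrt_le_left h0).1 he

/-- The comparisons with `sqDist r` fix which pairs belong to the graphs with closed and with open
threshold. Reachability in these two graphs decides `≤` and `<`, hence the sign of the difference.
-/
theorem determinedByOrder_sqFrechet : DeterminedByOrder (sqDist (n := n)) sqFrechet := by
  intro B r h x hx y hy
  have hle : sqFrechet x ≤ sqDist r x ↔ sqFrechet y ≤ sqDist r y := by
    rw [sqFrechet_le_iff, sqFrechet_le_iff]
    simp only [fun e => (h e).le_iff hx hy]
  have hlt : sqFrechet x < sqDist r x ↔ sqFrechet y < sqDist r y := by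
    rw [sqFrechet_lt_iff, sqFrechet_lt_iff]
    simp only [fun e => (h e).lt_iff hx hy]
  rcases lt_trichotomy (sqFrechet x) (sqDist r x) with h1 | h1 | h1
  · have := hlt.1 h1
    rw [sign_neg (by linarith), sign_neg (by linarith)]
  · have h2 := hle.1 h1.le
    have h3 := hlt.not.1 h1.not_lt
    have h4 : sqFrechet y = sqDist r y := le_antisymm h2 (not_lt.1 h3)
    simp only [h1, h4, sub_self]
  · have := not_le.1 (hle.not.1 (not_le.2 h1))
    rw [sign_pos (by linarith), sign_pos (by linarith)]

/-- Since `n² ≤ 2 ^ (4 * L)`, there are fewer than `2 ^ (8 * L + 3)` pairs of bounds and `4 * L + 1`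
rounds suffice; `4 * L + 10` steps search a net. Each round costs `O(s³ L²)`. -/
theorem exists_tree_depth_le {s L : ℕ} (hn : n ≤ s ^ 2) (hs1 : 1 ≤ s) (hL : 1 ≤ L)
    (hs : s ≤ 2 ^ L) :
    ∃ T : ACT (FrechetVar n) 0, T.SolvesDiscreteFrechet ∧ T.depth ≤ 172643 * (s ^ 3 * L ^ 3) := by
  set D := s ^ 3 * (69 * L + 223) with hD
  have hL2 : L < 2 ^ L := Nat.lt_two_pow_self
  have hs3 : 1 ≤ s ^ 3 := Nat.one_le_pow _ _ hs1
  have hn2 : n * n ≤ 2 ^ (4 * L) := by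
    have h1 : n ≤ 2 ^ (2 * L) := by
      rw [mul_comm, pow_mul]
      exact hn.trans (Nat.pow_le_pow_left hs 2)
    calc n * n ≤ 2 ^ (2 * L) * 2 ^ (2 * L) := Nat.mul_le_mul h1 h1
      _ = 2 ^ (4 * L) := by ring
  have h4L : 1 ≤ 2 ^ (4 * L) := Nat.one_le_two_pow
  have hcard : Fintype.card (Fin n × Fin n) = n * n := by simp
  have ha : Fintype.card (Option (Fin n × Fin n) × Option (Fin n × Fin n)) < 2 ^ (8 * L + 3) := by
    rw [Fintype.card_prod, Fintype.card_option, hcard]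
    have e : 2 ^ (8 * L + 3) = 8 * (2 ^ (4 * L) * 2 ^ (4 * L)) := by ring
    rw [e]
    have : n * n + 1 ≤ 2 * 2 ^ (4 * L) := by omega
    nlinarith [Nat.mul_le_mul this this]
  have hsL : L ≤ s ^ 3 * L := Nat.le_mul_of_pos_left _ hs3
  have hD' : D ≤ 292 * (s ^ 3 * L) := by
    have : 69 * L + 223 ≤ 292 * L := by omega
    calc D ≤ s ^ 3 * (292 * L) := Nat.mul_le_mul_left _ this
      _ = _ := by ring
  have hcD : 7 + D ≤ 299 * (s ^ 3 * L) := by omega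
  have hm : 8 * L + 3 + 2 * (7 + D) ≤ 609 * (s ^ 3 * L) := by omega
  have hq : 8 * L + 3 + 2 * (7 + D) < 2 ^ (4 * L + 10) := by
    refine hm.trans_lt ?_
    have h1 : s ^ 3 * L ≤ (2 ^ L) ^ 3 * 2 ^ L := Nat.mul_le_mul (Nat.pow_le_pow_left hs 3) hL2.le
    have e : 2 ^ (4 * L + 10) = 1024 * ((2 ^ L) ^ 3 * 2 ^ L) := by ring
    have : 0 < (2 ^ L) ^ 3 * 2 ^ L := by positivity
    omega
  -- The squared distance of the first pair is only a default for the extra candidate `b`; all pairs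
  -- are candidates at the start. The last node takes the square root.
  have hfind := (((comparable_sqDist hn hs).compute (0, 0) (inputFunctions n) Set.univ subset_rfl).bind
    fun K A hK _ hb => (comparable_sqDist hn hs).find determinedByOrder_sqFrechet ha hq (4 * L + 1)
      (E := Finset.univ) hK hb (fun x _ => .inr ((sqFrechet_eq x).imp fun e he =>
        ⟨Finset.mem_univ e, he⟩)) (by rw [Finset.card_univ, hcard, pow_succ]; omega)).bind (d' := 1)
    (Ψ := fun K' A' => ∃ f ∈ K', ∀ x ∈ A', IsDiscreteFrechetDist x.1 x.2 (f x))
    fun K A _ _ ⟨b, hb, hTb⟩ => .sqrt hb (fun x hx => hTb x hx ▸ sqFrechet_nonneg x)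
      (.done ⟨_, Set.mem_insert _ _, fun x hx => by
        rw [← hTb x hx]
        exact isDiscreteFrechetDist_sqrt x⟩)
  obtain ⟨T, hT, hrun⟩ := hfind.exists_act (inp := fun x : SeqPair n => frechetInput x.1 x.2)
    (fun x r => IsDiscreteFrechetDist x.1 x.2 r) (fun _ => Fin.elim0) (by
      rintro _ ⟨w, rfl⟩
      exact ⟨.inl w, fun x _ => rfl⟩)
  refine ⟨T, fun P Q => hrun (P, Q) (Set.mem_univ _), hT.trans ?_⟩
  rw [← hD]
  generalize hmm : 8 * L + 3 + 2 * (7 + D) = m at *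
  generalize hcc : 2 * (7 + D) = c2 at *
  have hq' : 4 * L + 10 ≤ 14 * L := by omega
  have hL1 : s ^ 3 * L ≤ s ^ 3 * L ^ 2 := Nat.mul_le_mul_left _ (by nlinarith)
  have i1 : m * 7 ≤ 4263 * (s ^ 3 * L ^ 2) := by omega
  have i2 : m * ((4 * L + 10) * 3) ≤ 25578 * (s ^ 3 * L ^ 2) :=
    calc m * ((4 * L + 10) * 3) ≤ 609 * (s ^ 3 * L) * (14 * L * 3) := by gcongr
      _ = _ := by ring
  have i3 : (4 * L + 10) * D ≤ 4088 * (s ^ 3 * L ^ 2) :=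
    calc (4 * L + 10) * D ≤ 14 * L * (292 * (s ^ 3 * L)) := by gcongr
      _ = _ := by ring
  have i4 : c2 ≤ 598 * (s ^ 3 * L ^ 2) := by omega
  have i5 : 8 ≤ 8 * (s ^ 3 * L ^ 3) := by
    have : 1 ≤ s ^ 3 * L ^ 3 := Nat.one_le_iff_ne_zero.2 (by positivity)
    omega
  calc 7 + (4 * L + 1) * (m * 7 + (m * ((4 * L + 10) * 3) + ((4 * L + 10) * D + c2))) + 1
      ≤ 7 + (5 * L) * (34527 * (s ^ 3 * L ^ 2)) + 1 := by
        gcongr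
        · omega
        · omega
    _ = 8 + 172635 * (s ^ 3 * L ^ 3) := by ring
    _ ≤ _ := by omega

end Frechet

/-! ### The bound in terms of `n` -/

theorem mainTheorem6 :
    ∃ (C : ℝ) (k : ℕ), ∀ (n : ℕ) [NeZero n],
      ∃ T : ACT (FrechetVar n) 0, T.SolvesDiscreteFrechet ∧
        (T.depth : ℝ) ≤ C * (n : ℝ) ^ (3 / 2 : ℝ) * Real.log ((n : ℝ) + 1) ^ k := by
  -- The factor `512 = 8 * 4 ^ 3` comes from `s ≤ 2 √n` and `L ≤ 4 log (n + 1)`.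
  refine ⟨172643 * 512, 3, fun n _ => ?_⟩
  have hn1 : 1 ≤ n := Nat.one_le_iff_ne_zero.2 (NeZero.ne n)
  set s := n.sqrt + 1 with hs
  set L := Nat.log 2 s + 1 with hL
  obtain ⟨T, hT, hd⟩ := exists_tree_depth_le (n := n) (s := s) (L := L) (Nat.lt_succ_sqrt' n).le
    (by omega) (by omega) (Nat.lt_pow_succ_log_self one_lt_two s).le
  refine ⟨T, hT, ?_⟩
  have hnr : (1 : ℝ) ≤ n := by exact_mod_cast hn1
  have hsr : (s : ℝ) ≤ 2 * Real.sqrt n := by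
    have h1 : ((n.sqrt : ℕ) : ℝ) ≤ Real.sqrt n := Real.nat_sqrt_le_real_sqrt
    have h2 : 1 ≤ Real.sqrt n := Real.one_le_sqrt.2 hnr
    rw [hs]
    push_cast
    linarith
  have hs3 : (s : ℝ) ^ 3 ≤ 8 * (n : ℝ) ^ (3 / 2 : ℝ) := by
    have e : (n : ℝ) ^ (3 / 2 : ℝ) = Real.sqrt n ^ 3 := by
      rw [Real.sqrt_eq_rpow, ← Real.rpow_natCast, ← Real.rpow_mul (by linarith)]
      norm_num
    rw [e]
    calc (s : ℝ) ^ 3 ≤ (2 * Real.sqrt n) ^ 3 := by gcongr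
      _ = _ := by ring
  have hlog2 : (1 / 2 : ℝ) ≤ Real.log 2 := by linarith [Real.log_two_gt_d9]
  have hlog : Real.log 2 ≤ Real.log ((n : ℝ) + 1) := Real.log_le_log (by norm_num) (by linarith)
  have hLr : (L : ℝ) ≤ 4 * Real.log ((n : ℝ) + 1) := by
    have h1 : (2 : ℝ) ^ Nat.log 2 s ≤ (n : ℝ) + 1 := by
      have h2 : 2 ^ Nat.log 2 s ≤ s := Nat.pow_log_le_self 2 (by omega)
      have h3 : s ≤ n + 1 := Nat.succ_le_succ (Nat.sqrt_le_self n)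
      exact_mod_cast h2.trans h3
    have h2 := Real.log_le_log (by positivity) h1
    rw [Real.log_pow] at h2
    have h3 : (Nat.log 2 s : ℝ) * (1 / 2) ≤ Nat.log 2 s * Real.log 2 := by gcongr
    rw [hL]
    push_cast
    linarith
  calc (T.depth : ℝ) ≤ 172643 * ((s : ℝ) ^ 3 * (L : ℝ) ^ 3) := by exact_mod_cast hd
    _ ≤ 172643 * ((8 * (n : ℝ) ^ (3 / 2 : ℝ)) * (4 * Real.log ((n : ℝ) + 1)) ^ 3) := by gcongr
    _ = _ := by ring
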